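/- All graphs are finite and simple. For a graph $G$ let $d_G$ denote the distance, with $d_G(u,v)=\infty$ if $u,v$ lie in different components. A $k$-term arithmetic progression ($k$-AP) in $G$ is a list $(v_1,\dots,v_k)$ of vertices such that, for some non-negative integer $d$, $d_G(v_i,v_{i+1})=d$ for $1\le i<k$; it is rainbow under a coloring $c$ if $c(v_1),\dots,c(v_k)$ are distinct. The anti-van der Waerden number $\mathrm{aw}(G,k)$ is the least $r\ge 1$ such that every surjective map $c:V(G)\to\{1,\dots,r\}$ admits a rainbow $k$-AP. A vertex of a connected graph is peripheral if its eccentricity equals the diameter. A graph $G$ is $3$-peripheral if it has three distinct vertices pairwise at distance $\mathrm{diam}(G)$. For a tree $T$ and a peripheral vertex $v$ let $T_{v^-}$ be obtained from $T$ by deleting all vertices at distance $\mathrm{diam}(T)$ from $v$; for any vertex $u$ let $T_{u^+}$ be obtained from $T$ by attaching a new leaf to $u$. A tree $T$ with at least two vertices is weakly non-$3$-peripheral if it is not $3$-peripheral and either $\mathrm{diam}(T)$ is odd and $T_{v^-}$ is $3$-peripheral for every peripheral vertex $v$, or $\mathrm{diam}(T)$ is even and $T_{u^+}$ is $3$-peripheral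 for some vertex $u$. For trees $T,T'$ with at least two vertices each, let $(\ast)$ be the condition that at least one of the following holds: (i) $T$ or $T'$ is $3$-peripheral; (ii) $\mathrm{diam}(T\square T')$ is even and $T$ or $T'$ is isomorphic to the path $P_2$ on two vertices; (iii) $\mathrm{diam}(T\square T')$ is even and $T$ or $T'$ is weakly non-$3$-peripheral. Theorem. Let $F_1$ and $F_2$ be forests without isolated vertices. Let $P$ be the set of connected components $C$ of the Cartesian product $F_1\square F_2$ with $\mathrm{aw}(C,3)=3$, and $S$ the set of those with $\mathrm{aw}(C,3)=4$. Then \[\mathrm{aw}(F_1\square F_2,3)=2|P|+3|S|+1 .\] Moreover, for $x\in V(F_1)$ and $y\in V(F_2)$ let $T$ and $T'$ be the components of $F_1$ and $F_2$ that contain $x$ and $y$; then the component of $F_1\square F_2$ containing $(x,y)$ belongs to $P$ if and only if $(T,T')$ satisfies $(\ast)$, and to $S$ if and only if $(T,T')$ does not satisfy $(\ast)$. Consequently $|P|$ is the number of pairs $(T,T')$, with $T$ a component of $F_1$ and $T'$ a component of $F_2$, that satisfy $(\ast)$, and $|S|$ is the number of such pairs that do not. -/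

import Mathlib

namespace SimpleGraph

variable {V W : Type*}

/-- A list of `k` vertices is an arithmetic progression in `G` if there is a (finite) common
difference `d` such that any two consecutive vertices are at distance exactly `d`.  The extended
distance is used, so that vertices in different components are at no finite distance. -/
def IsAP (G : SimpleGraph V) {k : ℕ} (v : Fin k → V) : Prop :=
  ∃ d : ℕ, ∀ i j : Fin k, (j : ℕ) = i + 1 → G.edist (v i) (v j) = d

/-- The coloring `c` (not necessarily proper) has a rainbow `k`-term arithmetic progression. -/
def HasRainbowAP (G : SimpleGraph V) {r : ℕ} (c : V → Fin r) (k : ℕ) : Prop :=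
  ∃ v : Fin k → V, G.IsAP v ∧ Function.Injective (c ∘ v)

/-- The anti-van der Waerden number `aw(G, k)`: the least positive `r` such that every exact
(i.e. surjective) `r`-coloring of the vertices of `G` has a rainbow `k`-term arithmetic
progression.  For a finite `G` every `r` exceeding the number of vertices qualifies. -/
noncomputable def antiVanDerWaerden (G : SimpleGraph V) (k : ℕ) : ℕ :=
  sInf {r : ℕ | 0 < r ∧ ∀ c : V → Fin r, Function.Surjective c → G.HasRainbowAP c k}

/-- A vertex is peripheral if its eccentricity is the diameter. -/
def IsPeripheral (G : SimpleGraph V) (v : V) : Prop :=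
  G.eccent v = G.ediam

/-- `G` contains `n` distinct vertices that are pairwise at distance `diam G`. -/
def IsNPeripheral (G : SimpleGraph V) (n : ℕ) : Prop :=
  ∃ u : Fin n → V, Function.Injective u ∧ ∀ i j : Fin n, i ≠ j → G.dist (u i) (u j) = G.diam

/-- The graph obtained from `T` by removing all vertices at distance `diam T` from `v`. -/
def removeDiametral (T : SimpleGraph V) (v : V) : SimpleGraph {w : V // T.dist v w ≠ T.diam} :=
  T.comap Subtype.val

/-- The graph obtained from `T` by adding a new vertex (namely `none`) adjacent to `u` only. -/
def addLeaf (T : SimpleGraph V) (u : V) : SimpleGraph (Option V) :=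
  T.map (Function.Embedding.some : V ↪ Option V) ⊔ edge none (some u)

/-- A (nontrivial) tree `T` that is not 3-peripheral is weakly non-3-peripheral if, in case its
diameter is odd, `T.removeDiametral v` is 3-peripheral for every peripheral `v`, and, in case its
diameter is even, `T.addLeaf u` is 3-peripheral for some `u`. -/
def IsWeaklyNonThreePeripheral (T : SimpleGraph V) : Prop :=
  ¬ T.IsNPeripheral 3 ∧
    ((Odd T.diam ∧ ∀ v : V, T.IsPeripheral v → (T.removeDiametral v).IsNPeripheral 3) ∨
      (Even T.diam ∧ ∃ u : V, (T.addLeaf u).IsNPeripheral 3))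

/-- The condition on a pair of nontrivial trees in the first case of the classification. -/
def ThreeCase (T : SimpleGraph V) (T' : SimpleGraph W) : Prop :=
  (T.IsNPeripheral 3 ∨ T'.IsNPeripheral 3) ∨
    (Even (T □ T').diam ∧ (Nonempty (T ≃g pathGraph 2) ∨ Nonempty (T' ≃g pathGraph 2))) ∨
    (Even (T □ T').diam ∧ (T.IsWeaklyNonThreePeripheral ∨ T'.IsWeaklyNonThreePeripheral))

/-- The set of connected components of `G`, as graphs of their own, with `aw(·, 3) = m`. -/
def componentsWithAW (G : SimpleGraph V) (m : ℕ) : Set G.ConnectedComponent :=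
  {C | C.toSimpleGraph.antiVanDerWaerden 3 = m}

end SimpleGraph

/-!
A coloring with `r` colors and no rainbow progression can be merged into one with fewer colors, so
`aw(G, 3) - 1` is the largest number of colors of a rainbow-free coloring. A progression lives in
one component, so this number is additive over components, and the components of `F₁ □ F₂` are the
products `T □ T'` of nontrivial trees. It remains to see that the maximum for such a product is two
or three, and when it is three.

Given a rainbow-free coloring of `T □ T'` with at least three colors, take a vertex `r` and an edge
`xb` carrying three distinct colors at minimal distance `k`. Then `r` and `b` have distance `k + 1`,
`k` is even, and minimality forces the colors within distance `k` of `r` or `b`. Hence `b` can be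
moved along the sphere of radius `k + 1` around `r`, and vice versa, keeping their colors. Every
vertex is within reach of such a move, so there is no fourth color, and the first coordinates `s`,
`s'` of the pair can be made diametral in `T`. A vertex at distance `T.diam` from both `s` and `s'`
would identify the colors of `r` and `b`, so `T` is not 3-peripheral. If `T.diam + T'.diam` is even,
then `k + 1` is smaller than this sum, and the additional room in `T'` shows that `s`, `s'` is a
slim pair; the same holds for `T'`.

Conversely, let `m` be the diameter sum if it is odd, and one less if it is even. Without
3-peripheral factors, and with slim pairs in the even case, there are two sets such that the sphere
of radius `m` around each vertex of one is the other; coloring them with two colors and the rest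
with a third is rainbow-free, because a vertex equidistant from a vertex of each set would give a
closed walk of odd length in the bipartite graph `T □ T'`. Finally, a tree has a slim pair if and
only if it is neither 3-peripheral, nor `P₂`, nor weakly non-3-peripheral.
-/

namespace AntiVanDerWaerden

open SimpleGraph

/-! ### Distances in connected, bipartite and product graphs -/

section Distance

variable {V W : Type*} {G : SimpleGraph V} {H : SimpleGraph W}

theorem edist_map_le (f : G →g H) (u v : V) : H.edist (f u) (f v) ≤ G.edist u v :=
  le_iInf fun p => p.length_map f ▸ edist_le (p.map f)

theorem edist_iso (φ : G ≃g H) (u v : V) : H.edist (φ u) (φ v) = G.edist u v :=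
  le_antisymm (edist_map_le φ.toHom u v) (by simpa using edist_map_le φ.symm.toHom (φ u) (φ v))

theorem dist_iso (φ : G ≃g H) (u v : V) : H.dist (φ u) (φ v) = G.dist u v :=
  congrArg ENat.toNat (edist_iso φ u v)

theorem exists_dist_eq_of_dist_eq_add (hG : G.Connected) {x y : V} {i j : ℕ}
    (h : G.dist x y = i + j) : ∃ z, G.dist x z = i ∧ G.dist z y = j := by
  obtain ⟨p, hp⟩ := hG.exists_walk_length_eq_dist x y
  have take_le := G.dist_le (p.take i)
  have drop_le := G.dist_le (p.drop i)
  have triangle := hG.dist_triangle (u := x) (v := p.getVert i) (w := y)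
  rw [Walk.take_length] at take_le
  rw [Walk.drop_length] at drop_le
  exact ⟨p.getVert i, by lia, by lia⟩

theorem exists_dist_eq_of_le (hG : G.Connected) {x y : V} {i : ℕ} (h : i ≤ G.dist x y) :
    ∃ z, G.dist x z = i ∧ G.dist z y = G.dist x y - i :=
  exists_dist_eq_of_dist_eq_add hG (by lia)

theorem exists_dist_eq_one [Nontrivial V] (hG : G.Connected) (v : V) : ∃ w, G.dist v w = 1 :=
  (hG.preconnected.exists_adj_of_nontrivial v).imp fun _ => dist_eq_one_iff_adj.mpr

theorem even_dist_add_dist_add_dist (hG : G.Connected) (hbip : G.IsBipartite) (x y z : V) :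
    Even (G.dist x y + G.dist y z + G.dist x z) := by
  obtain ⟨C⟩ := hbip
  let B : G.Coloring Bool := G.recolorOfEquiv finTwoEquiv C
  have even_iff (u v : V) : Even (G.dist u v) ↔ (B u ↔ B v) := by
    obtain ⟨p, hp⟩ := hG.exists_walk_length_eq_dist u v
    exact hp ▸ B.even_length_iff_congr p
  simp only [Nat.even_add, even_iff]
  tauto

theorem colorable_boxProd {n : ℕ} [NeZero n] (hG : G.Colorable n) (hH : H.Colorable n) :
    (G □ H).Colorable n := by
  obtain ⟨C⟩ := hG
  obtain ⟨D⟩ := hH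
  refine ⟨Coloring.mk (fun p => C p.1 + D p.2) fun {p q} hpq => ?_⟩
  rcases boxProd_adj.mp hpq with ⟨hadj, hsnd⟩ | ⟨hadj, hfst⟩
  · simpa [hsnd] using C.valid hadj
  · simpa [hfst] using D.valid hadj

theorem dist_boxProd (hG : G.Connected) (hH : H.Connected) (p q : V × W) :
    (G □ H).dist p q = G.dist p.1 q.1 + H.dist p.2 q.2 := by
  rw [SimpleGraph.dist, edist_boxProd, ← (hG p.1 q.1).coe_dist_eq_edist,
    ← (hH p.2 q.2).coe_dist_eq_edist, ← ENat.natCast_add, ENat.toNat_natCast]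

theorem dist_le_diam_of_connected [Finite V] (hG : G.Connected) (u v : V) :
    G.dist u v ≤ G.diam :=
  have := hG.nonempty
  dist_le_diam (connected_iff_ediam_ne_top.mp hG)

theorem diam_boxProd [Finite V] [Finite W] (hG : G.Connected) (hH : H.Connected) :
    (G □ H).diam = G.diam + H.diam := by
  have := hG.nonempty
  have := hH.nonempty
  apply le_antisymm
  · obtain ⟨p, q, hpq⟩ := (G □ H).exists_dist_eq_diam
    rw [← hpq, dist_boxProd hG hH]
    exact add_le_add (dist_le_diam_of_connected hG _ _) (dist_le_diam_of_connected hH _ _)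
  · obtain ⟨u, v, huv⟩ := G.exists_dist_eq_diam
    obtain ⟨x, y, hxy⟩ := H.exists_dist_eq_diam
    rw [← huv, ← hxy, ← dist_boxProd hG hH (u, x) (v, y)]
    exact dist_le_diam_of_connected (hG.boxProd hH) _ _

theorem diam_ne_zero_of_connected [Finite V] [Nontrivial V] (hG : G.Connected) : G.diam ≠ 0 :=
  diam_ne_zero_of_ediam_ne_top (connected_iff_ediam_ne_top.mp hG)

theorem isNPeripheral_three_iff (hd : G.diam ≠ 0) :
    G.IsNPeripheral 3 ↔
      ∃ x y z, G.dist x y = G.diam ∧ G.dist y z = G.diam ∧ G.dist x z = G.diam := by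
  constructor
  · rintro ⟨u, -, hu⟩
    exact ⟨u 0, u 1, u 2, hu 0 1 (by decide), hu 1 2 (by decide), hu 0 2 (by decide)⟩
  · rintro ⟨x, y, z, hxy, hyz, hxz⟩
    have hdist (i j : Fin 3) (hij : i ≠ j) : G.dist (![x, y, z] i) (![x, y, z] j) = G.diam := by
      fin_cases i <;> fin_cases j <;> simp_all [SimpleGraph.dist_comm]
    refine ⟨![x, y, z], fun i j hij => ?_, hdist⟩
    by_contra hne
    exact hd (by rw [← hdist i j hne, hij, G.dist_self])

end Distance

/-! ### Distances in trees -/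

section Tree

variable {V : Type*} {T : SimpleGraph V}

theorem length_eq_dist_of_isPath (hT : T.IsTree) {u v : V} {p : T.Walk u v} (hp : p.IsPath) :
    p.length = T.dist u v := by
  obtain ⟨q, hq, hlen⟩ := hT.connected.exists_path_of_dist u v
  rw [← hlen, (hT.existsUnique_path u v).unique hp hq]

theorem dist_add_dist_of_mem_support (hT : T.IsTree) {a b y : V} {p : T.Walk a b}
    (hp : p.IsPath) (hy : y ∈ p.support) : T.dist a y + T.dist y b = T.dist a b := by
  obtain ⟨q, r, hq, hr, rfl⟩ := hp.mem_support_iff_exists_append.mp hy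
  rw [← length_eq_dist_of_isPath hT hp, Walk.length_append, length_eq_dist_of_isPath hT hq,
    length_eq_dist_of_isPath hT hr]

theorem dist_add_dist_of_mem_support_of_mem_support (hT : T.IsTree) {a b w w' : V}
    {p : T.Walk a b} (hp : p.IsPath) (hw : w ∈ p.support) (hw' : w' ∈ p.support) :
    T.dist a w + T.dist w w' = T.dist a w' ∨ T.dist a w' + T.dist w' w = T.dist a w := by
  obtain ⟨q, r, hq, hr, rfl⟩ := hp.mem_support_iff_exists_append.mp hw
  rcases (q.mem_support_append_iff r).mp hw' with hw' | hw'
  · exact .inr (dist_add_dist_of_mem_support hT hq hw')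
  · have left := dist_add_dist_of_mem_support hT hp hw
    have right := dist_add_dist_of_mem_support hT hr hw'
    have whole := dist_add_dist_of_mem_support hT hp ((q.mem_support_append_iff r).mpr (.inr hw'))
    exact .inl (by lia)

theorem exists_isPath_support_subset {G : SimpleGraph V} {u v w y : V} {p : G.Walk u v}
    (hp : p.IsPath) (hw : w ∈ p.support) (hy : y ∈ p.support) :
    ∃ s : G.Walk w y, s.IsPath ∧ s.support ⊆ p.support := by
  obtain ⟨q, r, hq, hr, rfl⟩ := hp.mem_support_iff_exists_append.mp hy
  rcases (q.mem_support_append_iff r).mp hw with hw | hw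
  · obtain ⟨q₁, q₂, -, hq₂, rfl⟩ := hq.mem_support_iff_exists_append.mp hw
    exact ⟨q₂, hq₂, fun z hz => by simp [Walk.mem_support_append_iff, hz]⟩
  · obtain ⟨r₁, r₂, hr₁, -, rfl⟩ := hr.mem_support_iff_exists_append.mp hw
    exact ⟨r₁.reverse, hr₁.reverse, fun z hz => by
      simp [Walk.mem_support_append_iff, List.mem_reverse.mp (r₁.support_reverse ▸ hz)]⟩

theorem exists_gate (hT : T.IsTree) {a b : V} {p : T.Walk a b} (hp : p.IsPath) (x : V) :
    ∃ w ∈ p.support, ∀ y ∈ p.support, T.dist x y = T.dist x w + T.dist w y := by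
  classical
  obtain ⟨w, hw, nearest⟩ := p.support.toFinset.exists_min_image (T.dist x) ⟨a, by simp⟩
  simp only [List.mem_toFinset] at hw nearest
  refine ⟨w, hw, fun y hy => ?_⟩
  obtain ⟨s, hs, hsub⟩ := exists_isPath_support_subset hp hw hy
  obtain ⟨q, hq, hlen⟩ := hT.connected.exists_path_of_dist x w
  have meet_only_at_gate : ∀ v ∈ q.support, v ∈ s.support → v = w := fun v hvq hvs => by
    have := dist_add_dist_of_mem_support hT hq hvq
    have := nearest v (hsub hvs)
    exact hT.connected.dist_eq_zero_iff.mp (by lia)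
  have hw_tail : w ∉ s.support.tail := by
    have := hs.support_nodup
    rw [← s.cons_tail_support] at this
    exact (List.nodup_cons.mp this).1
  have hpath : (q.append s).IsPath := by
    rw [Walk.isPath_def, Walk.support_append, List.nodup_append']
    exact ⟨hq.support_nodup, hs.support_nodup.tail, fun v hvq hvs =>
      hw_tail (meet_only_at_gate v hvq (List.mem_of_mem_tail hvs) ▸ hvs)⟩
  rw [← length_eq_dist_of_isPath hT hpath, Walk.length_append, length_eq_dist_of_isPath hT hs,
    hlen]

theorem dist_add_dist_le_max (hT : T.IsTree) (a b c e : V) :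
    T.dist a b + T.dist c e ≤
      max (T.dist a c + T.dist b e) (T.dist a e + T.dist b c) := by
  obtain ⟨p, hp, -⟩ := hT.connected.exists_path_of_dist a b
  obtain ⟨w, hw, gate_c⟩ := exists_gate hT hp c
  obtain ⟨w', hw', gate_e⟩ := exists_gate hT hp e
  have := gate_c a p.start_mem_support
  have := gate_c b p.end_mem_support
  have := gate_e a p.start_mem_support
  have := gate_e b p.end_mem_support
  have := dist_add_dist_of_mem_support hT hp hw
  have := dist_add_dist_of_mem_support hT hp hw'
  have := hT.connected.dist_triangle (u := c) (v := w) (w := e)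
  have := hT.connected.dist_triangle (u := w) (v := w') (w := e)
  have := dist_add_dist_of_mem_support_of_mem_support hT hp hw hw'
  grind [SimpleGraph.dist_comm]

theorem dist_of_equidistant (hT : T.IsTree) {s x y z : V} (hx : T.dist s x = T.dist s z)
    (hadd : T.dist z y + T.dist y x = T.dist z x) (hle : T.dist z x ≤ 2 * T.dist z y) :
    T.dist s y + T.dist z x = T.dist s z + T.dist z y := by
  have := dist_add_dist_le_max hT s y z x
  have := hT.connected.dist_triangle (u := s) (v := y) (w := x)
  grind [SimpleGraph.dist_comm]

theorem even_dist_of_equidistant (hT : T.IsTree) {s x z : V} (hx : T.dist s x = T.dist s z) :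
    Even (T.dist z x) := by
  have := even_dist_add_dist_add_dist hT.connected hT.isBipartite s z x
  grind

theorem exists_dist_eq_diam_of_farthest [Finite V] (hT : T.IsTree) {s x : V}
    (hx : ∀ v, T.dist s v ≤ T.dist s x) : ∃ v, T.dist x v = T.diam := by
  have := hT.connected.nonempty
  obtain ⟨u, v, huv⟩ := T.exists_dist_eq_diam
  have := dist_add_dist_le_max hT s x u v
  have := hx u
  have := hx v
  have := dist_le_diam_of_connected hT.connected x u
  have := dist_le_diam_of_connected hT.connected x v
  by_cases hu : T.dist x u = T.diam
  · exact ⟨u, hu⟩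
  · exact ⟨v, by lia⟩

theorem exists_dist_eq_dist_add_one (hT : T.IsTree) {t t' u v : V}
    (h : T.dist t t' < T.dist u v) :
    ∃ z, T.dist t z = T.dist t t' + 1 ∨ T.dist t' z = T.dist t t' + 1 := by
  have := dist_add_dist_le_max hT t t' u v
  obtain ⟨x, hx⟩ : ∃ x, T.dist t t' + 1 ≤ T.dist t x ∨ T.dist t t' + 1 ≤ T.dist t' x := by
    by_contra! hle
    have := hle u
    have := hle v
    lia
  rcases hx with hx | hx
  · exact (exists_dist_eq_of_le hT.connected hx).imp fun _ hz => .inl hz.1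
  · exact (exists_dist_eq_of_le hT.connected hx).imp fun _ hz => .inr hz.1

end Tree

/-! ### Rainbow-free colorings and good pairs -/

/-- A coloring without rainbow `3`-term arithmetic progressions, for an arbitrary set of colors.
The first condition says that `u` and `v` lie in the same component, so that `G.edist u v` is a
possible common difference. -/
def RainbowFree {V κ : Type*} (G : SimpleGraph V) (c : V → κ) : Prop :=
  ∀ u v w, G.edist u v ≠ ⊤ → G.edist u v = G.edist v w → c u = c v ∨ c v = c w ∨ c u = c w

/-- A rainbow-free coloring of a connected graph in which a vertex has distance at least `k` from
each edge whose ends carry two further colors. The largest such `k` is the parameter that governs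
the structure of a rainbow-free coloring with at least three colors. -/
structure GapColoring {V κ : Type*} (G : SimpleGraph V) (c : V → κ) (k : ℕ) : Prop where
  connected : G.Connected
  rainbowFree : RainbowFree G c
  le_dist : ∀ {x y z}, G.Adj x y → c x ≠ c y → c z ≠ c x → c z ≠ c y → k ≤ G.dist z x

/-- Two vertices `r` and `b` that realize the parameter `k` of a gap coloring: the last edge of some
geodesic of length `k + 1` from `r` to `b` is bicolored, with colors `ω` and `c b` different from
the color of `r`. -/
structure GoodPair {V κ : Type*} (G : SimpleGraph V) (c : V → κ) (k : ℕ) (ω : κ) (r b : V) : Prop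
    extends GapColoring G c k where
  color_ne : c r ≠ c b
  ne_left : ω ≠ c r
  ne_right : ω ≠ c b
  dist_eq : G.dist r b = k + 1
  exists_adj_right : ∃ x, c x = ω ∧ G.Adj x b ∧ G.dist r x = k

section GoodPair

variable {V κ : Type*} {G : SimpleGraph V} {c : V → κ} {k : ℕ} {ω : κ} {r b u v w x : V}

theorem RainbowFree.eq_or_eq_or_eq (hc : RainbowFree G c) (hG : G.Connected)
    (h : G.dist u v = G.dist v w) : c u = c v ∨ c v = c w ∨ c u = c w :=
  hc u v w (edist_ne_top_iff_reachable.mpr (hG u v))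
    (by rw [← (hG u v).coe_dist_eq_edist, h, (hG v w).coe_dist_eq_edist])

theorem RainbowFree.comp {W : Type*} {H : SimpleGraph W} (hc : RainbowFree G c) {f : W → V}
    (hf : ∀ u v, G.edist (f u) (f v) = H.edist u v) : RainbowFree H (c ∘ f) := fun u v w huv h =>
  hc (f u) (f v) (f w) (by rwa [hf]) (by rwa [hf, hf])

namespace GapColoring

theorem eq_or_eq_or_eq (hc : GapColoring G c k) (h : G.dist u v = G.dist v w) :
    c u = c v ∨ c v = c w ∨ c u = c w :=
  hc.rainbowFree.eq_or_eq_or_eq hc.connected h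

theorem color_eq_of_dist_lt (hc : GapColoring G c k) (hxb : G.Adj x b) (hne : c x ≠ c b)
    (hlt : G.dist v x < k) : c v = c x ∨ c v = c b := by
  by_contra! h
  exact hlt.not_ge (hc.le_dist hxb hne h.1 h.2)

theorem color_eq_of_dist_add_dist (hc : GapColoring G c k) (hxb : G.Adj x b)
    (hrx : G.dist r x = k) (hrb : c r ≠ c b) (hxr : c x ≠ c r) (hne : c x ≠ c b) (hv : v ≠ r)
    (hadd : G.dist r v + G.dist v x = k) : c v = c x := by
  obtain ⟨i, hi⟩ : ∃ i, G.dist r v = i + 1 :=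
    Nat.exists_eq_add_one.mpr (hc.connected.pos_dist_of_ne hv.symm)
  induction i generalizing v with
  | zero =>
    refine (hc.color_eq_of_dist_lt hxb hne (by lia)).resolve_right fun hvb => ?_
    have := hc.le_dist (dist_eq_one_iff_adj.mp hi).symm (hvb.trans_ne hrb.symm)
      (hvb ▸ hne) hxr
    grind [SimpleGraph.dist_comm]
  | succ i ih =>
    obtain ⟨u, hru, huv⟩ := exists_dist_eq_of_dist_eq_add hc.connected hi
    have := hc.connected.dist_triangle (u := r) (v := u) (w := x)
    have := hc.connected.dist_triangle (u := u) (v := v) (w := x)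
    have hur : u ≠ r := by
      rintro rfl
      simp at hru
    have hux : c u = c x := ih hur (by lia) hru
    refine (hc.color_eq_of_dist_lt hxb hne (by lia)).resolve_right fun hvb => ?_
    have := hc.le_dist (dist_eq_one_iff_adj.mp huv) (hux ▸ hvb ▸ hne) (hux ▸ hxr.symm)
      (hvb ▸ hrb)
    lia

end GapColoring

namespace GoodPair

theorem two_le (h : GoodPair G c k ω r b) : 2 ≤ k := by
  obtain ⟨x, rfl, hxb, hrx⟩ := h.exists_adj_right
  have := h.color_ne
  have := h.ne_left
  have := h.ne_right
  by_contra! hk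
  obtain rfl | rfl : k = 0 ∨ k = 1 := by lia
  · exact h.ne_left (congrArg c (h.connected.dist_eq_zero_iff.mp hrx)).symm
  · have := h.eq_or_eq_or_eq (hrx.trans (dist_eq_one_iff_adj.mpr hxb).symm)
    grind

theorem exists_adj_left (h : GoodPair G c k ω r b) :
    ∃ z, c z = ω ∧ G.Adj r z ∧ G.dist z b = k := by
  have := h.two_le
  have := h.dist_eq
  obtain ⟨x, rfl, hxb, hrx⟩ := h.exists_adj_right
  obtain ⟨z, hrz, hzx⟩ := exists_dist_eq_of_dist_eq_add h.connected (i := 1) (j := k - 1)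
    (hrx.trans (by lia))
  have := h.connected.dist_triangle (u := z) (v := x) (w := b)
  have := h.connected.dist_triangle (u := r) (v := z) (w := b)
  have := dist_eq_one_iff_adj.mpr hxb
  have hadj := dist_eq_one_iff_adj.mp hrz
  exact ⟨z, h.color_eq_of_dist_add_dist hxb hrx h.color_ne h.ne_left h.ne_right hadj.ne'
    (by lia), hadj, by lia⟩

theorem symm (h : GoodPair G c k ω r b) : GoodPair G c k ω b r where
  toGapColoring := h.toGapColoring
  color_ne := h.color_ne.symm
  ne_left := h.ne_right
  ne_right := h.ne_left
  dist_eq := G.dist_comm.trans h.dist_eq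
  exists_adj_right := h.exists_adj_left.imp fun _ ⟨hz, hrz, hzb⟩ =>
    ⟨hz, hrz.symm, G.dist_comm.trans hzb⟩

theorem of_color_eq (h : GoodPair G c k ω r b) (hv : c v = c b) (hrv : G.dist r v = k + 1)
    (hw : c w = ω) (hwv : G.Adj w v) (hrw : G.dist r w = k) : GoodPair G c k ω r v where
  toGapColoring := h.toGapColoring
  color_ne := hv ▸ h.color_ne
  ne_left := h.ne_left
  ne_right := hv ▸ h.ne_right
  dist_eq := hrv
  exists_adj_right := ⟨w, hw, hwv, hrw⟩

theorem color_eq_of_dist_right_le (h : GoodPair G c k ω r b) (hv : G.dist v b ≤ k) :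
    c v = ω ∨ c v = c b := by
  obtain ⟨z, hz, -, hzb⟩ := h.exists_adj_left
  obtain ⟨x, hx, hxb, -⟩ := h.exists_adj_right
  by_contra! hne
  have := h.le_dist hxb.symm (hx ▸ h.ne_right.symm) hne.2 (hx ▸ hne.1)
  have := h.eq_or_eq_or_eq (u := v) (v := b) (w := z) (by grind [SimpleGraph.dist_comm])
  grind [h.ne_right]

theorem color_eq_of_dist_left_le (h : GoodPair G c k ω r b) (hv : G.dist r v ≤ k) :
    c v = ω ∨ c v = c r :=
  h.symm.color_eq_of_dist_right_le (G.dist_comm ▸ hv)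

theorem color_eq_of_dist_le_of_dist_le (h : GoodPair G c k ω r b) (hr : G.dist r v ≤ k)
    (hb : G.dist v b ≤ k) : c v = ω := by
  have := h.color_eq_of_dist_left_le hr
  have := h.color_eq_of_dist_right_le hb
  grind [h.color_ne]

theorem lt_dist_right_of_color_eq (h : GoodPair G c k ω r b) (hv : c v = c r) :
    k < G.dist v b := by
  by_contra! hle
  have := h.color_eq_of_dist_right_le hle
  grind [h.color_ne, h.ne_left]

theorem color_eq_of_dist_left_eq (h : GoodPair G c k ω r b) (hv : G.dist r v = k + 1) :
    c v = c r ∨ c v = c b := by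
  have := h.eq_or_eq_or_eq (u := v) (v := r) (w := b)
    (G.dist_comm.trans (hv.trans h.dist_eq.symm))
  grind [h.color_ne]

theorem color_eq_of_dist_right_eq (h : GoodPair G c k ω r b) (hv : G.dist v b = k + 1) :
    c v = c r ∨ c v = c b :=
  (h.symm.color_eq_of_dist_left_eq (G.dist_comm.trans hv)).symm

theorem color_eq_of_goodPair (h : GoodPair G c k ω r b) (h' : GoodPair G c k ω r v) :
    c v = c b :=
  (h.color_eq_of_dist_left_eq h'.dist_eq).resolve_left h'.color_ne.symm

theorem even (h : GoodPair G c k ω r b) : Even k := by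
  -- For odd `k` the midpoint of a geodesic from `r` to `b` would give a rainbow progression.
  by_contra hodd
  have := h.two_le
  obtain ⟨j, hj⟩ := Nat.not_even_iff_odd.mp hodd
  obtain ⟨m, hrm, hmb⟩ := exists_dist_eq_of_dist_eq_add h.connected (i := j + 1) (j := j + 1)
    (h.dist_eq.trans (by lia))
  have := h.color_eq_of_dist_le_of_dist_le (v := m) (by lia) (by lia)
  have := h.eq_or_eq_or_eq (hrm.trans hmb.symm)
  grind [h.color_ne, h.ne_left, h.ne_right]

theorem color_eq_of_common_neighbor (h : GoodPair G c k ω r b) (hrw : G.dist r w = k)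
    (hwb : G.Adj w b) (hwv : G.Adj w v) (hrv : G.dist r v = k + 1) : c v = c b := by
  have := h.two_le
  have hwb' := dist_eq_one_iff_adj.mpr hwb
  have := h.color_eq_of_dist_le_of_dist_le (v := w) (by lia) (by lia)
  have := h.color_eq_of_dist_left_eq hrv
  have := h.eq_or_eq_or_eq (u := v) (v := w) (w := b)
    ((dist_eq_one_iff_adj.mpr hwv.symm).trans hwb'.symm)
  grind [h.ne_left, h.ne_right]

theorem of_common_neighbor (h : GoodPair G c k ω r b) (hrw : G.dist r w = k)
    (hwb : G.Adj w b) (hwv : G.Adj w v) (hrv : G.dist r v = k + 1) : GoodPair G c k ω r v := by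
  have hw : c w = ω := h.color_eq_of_dist_le_of_dist_le hrw.le
    ((dist_eq_one_iff_adj.mpr hwb).trans_le (one_le_two.trans h.two_le))
  exact h.of_color_eq (h.color_eq_of_common_neighbor hrw hwb hwv hrv) hrv hw hwv hrw

theorem comp_iso {W : Type*} {H : SimpleGraph W} (h : GoodPair G c k ω r b) (φ : H ≃g G) :
    GoodPair H (c ∘ φ) k ω (φ.symm r) (φ.symm b) where
  connected := φ.connected_iff.mpr h.connected
  rainbowFree := h.rainbowFree.comp (edist_iso φ)
  le_dist hxy hne hzx hzy := (h.le_dist (φ.map_adj_iff.mpr hxy) hne hzx hzy).trans_eq (dist_iso ..)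
  color_ne := by simpa using h.color_ne
  ne_left := by simpa using h.ne_left
  ne_right := by simpa using h.ne_right
  dist_eq := (dist_iso φ.symm r b).trans h.dist_eq
  exists_adj_right := by
    obtain ⟨x, hx, hxb, hrx⟩ := h.exists_adj_right
    exact ⟨φ.symm x, by simpa using hx, φ.symm.map_adj_iff.mpr hxb,
      (dist_iso φ.symm r x).trans hrx⟩

end GoodPair

theorem exists_adj_color_ne (hG : G.Connected) (h : c u ≠ c v) :
    ∃ x y, G.Adj x y ∧ c x ≠ c y := by
  obtain ⟨p⟩ := hG u v
  obtain ⟨d, -, hfst, hsnd⟩ := p.exists_boundary_dart {x | c x = c u} rfl h.symm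
  exact ⟨d.fst, d.snd, d.adj, fun heq => hsnd (heq.symm.trans hfst)⟩

theorem exists_goodPair (hG : G.Connected) (hbip : G.IsBipartite) (hc : RainbowFree G c)
    (huv : c u ≠ c v) (huw : c u ≠ c w) (hvw : c v ≠ c w) : ∃ k ω r b, GoodPair G c k ω r b := by
  classical
  obtain ⟨x₀, y₀, hadj₀, hne₀⟩ := exists_adj_color_ne hG huv
  obtain ⟨z₀, hzx₀, hzy₀⟩ : ∃ z, c z ≠ c x₀ ∧ c z ≠ c y₀ := by grind
  have hex : ∃ k x y z, G.Adj x y ∧ c x ≠ c y ∧ c z ≠ c x ∧ c z ≠ c y ∧ G.dist z x = k :=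
    ⟨_, x₀, y₀, z₀, hadj₀, hne₀, hzx₀, hzy₀, rfl⟩
  obtain ⟨x, y, z, hadj, hne, hzx, hzy, hk⟩ := Nat.find_spec hex
  have hgap : GapColoring G c (Nat.find hex) :=
    ⟨hG, hc, fun hxy hne hzx hzy => Nat.find_min' hex ⟨_, _, _, hxy, hne, hzx, hzy, rfl⟩⟩
  have hdist : G.dist z y = Nat.find hex + 1 := by
    have := hgap.le_dist hadj.symm hne.symm hzy hzx
    have := hG.dist_triangle (u := z) (v := x) (w := y)
    have := dist_eq_one_iff_adj.mpr hadj
    obtain ⟨m, hm⟩ := even_dist_add_dist_add_dist hG hbip z x y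
    lia
  exact ⟨_, c x, z, y, hgap, hzy, hzx.symm, hne, hdist, x, rfl, hadj, hk⟩

end GoodPair

/-! ### Good pairs in products of trees -/

section ProductOfTrees

variable {V W κ : Type*} {T : SimpleGraph V} {T' : SimpleGraph W} {c : V × W → κ} {k : ℕ} {ω : κ}
  {s s' x : V} {t t' y : W}

namespace GoodPair

theorem swap (h : GoodPair (T □ T') c k ω (s, t) (s', t')) :
    GoodPair (T' □ T) (c ∘ Prod.swap) k ω (t, s) (t', s') :=
  h.comp_iso (boxProdComm T' T)

theorem dist_add_dist (hT : T.IsTree) (hT' : T'.IsTree)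
    (h : GoodPair (T □ T') c k ω (s, t) (s', t')) : T.dist s s' + T'.dist t t' = k + 1 :=
  (dist_boxProd hT.connected hT'.connected _ _).symm.trans h.dist_eq

theorem snd_ne [Nontrivial W] (hT : T.IsTree) (hT' : T'.IsTree)
    (h : GoodPair (T □ T') c k ω (s, t) (s', t')) : t ≠ t' := by
  -- If `t = t'`, then moving the last and the first vertex of a geodesic between the two vertices
  -- to a neighbor of `t` brings the two colors within distance `k - 1` of each other.
  rintro rfl
  have hdist := dist_boxProd hT.connected hT'.connected
  have hss' : T.dist s s' = k + 1 := by simpa using h.dist_add_dist hT hT'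
  have := h.two_le
  obtain ⟨t₁, ht₁⟩ := exists_dist_eq_one hT'.connected t
  have hadj (a : V) : (T □ T').Adj (a, t) (a, t₁) := by
    simpa [boxProd_adj] using dist_eq_one_iff_adj.mp ht₁
  obtain ⟨s₁, hss₁, hs₁s'⟩ := exists_dist_eq_of_dist_eq_add hT.connected (i := 1) (j := k)
    (hss'.trans (by lia))
  obtain ⟨s₂, hs₁s₂, hs₂s'⟩ := exists_dist_eq_of_dist_eq_add hT.connected (i := k - 1) (j := 1)
    (hs₁s'.trans (by lia))
  have hs's₁ : T.dist s' s₁ = k := T.dist_comm.trans hs₁s'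
  have hss₂ : T.dist s s₂ = k := by
    have := hT.connected.dist_triangle (u := s) (v := s₁) (w := s₂)
    have := hT.connected.dist_triangle (u := s) (v := s₂) (w := s')
    lia
  have near_left : GoodPair (T □ T') c k ω (s, t) (s₂, t₁) :=
    h.of_common_neighbor (w := (s₂, t)) (by simp [hdist, hss₂])
      (boxProd_adj_left.mpr (dist_eq_one_iff_adj.mp hs₂s')) (hadj s₂) (by simp [hdist, hss₂, ht₁])
  have near_right : c (s₁, t₁) = c (s, t) :=
    h.symm.color_eq_of_common_neighbor (w := (s₁, t)) (by simp [hdist, hs's₁])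
      (boxProd_adj_left.mpr (dist_eq_one_iff_adj.mp hss₁).symm) (hadj s₁)
      (by simp [hdist, hs's₁, ht₁])
  have := near_left.lt_dist_right_of_color_eq near_right
  simp only [hdist, T'.dist_self] at this
  lia

theorem fst_ne [Nontrivial V] (hT : T.IsTree) (hT' : T'.IsTree)
    (h : GoodPair (T □ T') c k ω (s, t) (s', t')) : s ≠ s' :=
  h.swap.snd_ne hT' hT

theorem dist_le_of_equidistant [Nontrivial W] (hT : T.IsTree) (hT' : T'.IsTree)
    (h : GoodPair (T □ T') c k ω (s, t) (s', t')) (hx : T.dist s x = T.dist s s') :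
    T.dist s' x ≤ k := by
  -- Otherwise the vertex at distance `k + 1` from `s'` on the way to `x` would form a good pair
  -- with `s'` inside the fibre of `t'`.
  by_contra! hlt
  have hdist := dist_boxProd hT.connected hT'.connected
  have := h.dist_add_dist hT hT'
  have := hT'.connected.pos_dist_of_ne (h.snd_ne hT hT')
  obtain ⟨u, hs'u, hux⟩ := exists_dist_eq_of_le hT.connected hlt.nat_succ_le
  obtain ⟨w, hs'w, hwu⟩ := exists_dist_eq_of_dist_eq_add hT.connected (i := k) (j := 1) hs'u
  have := T.dist_comm (u := s') (v := s)
  have := T.dist_comm (u := s') (v := u)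
  have := T.dist_comm (u := s') (v := w)
  have := hT.connected.dist_triangle (u := s') (v := s) (w := x)
  have := hT.connected.dist_triangle (u := w) (v := u) (w := x)
  have := hT.connected.dist_triangle (u := s') (v := w) (w := x)
  have := dist_of_equidistant hT hx (y := u) (by lia) (by lia)
  obtain ⟨m, hm⟩ := even_dist_of_equidistant hT hx
  obtain ⟨j, hj⟩ := h.even
  have := dist_of_equidistant hT hx (y := w) (by lia) (by lia)
  have hw : c (w, t') = ω := h.color_eq_of_dist_le_of_dist_le
    (by simp only [hdist]; lia) (by simp only [hdist, T'.dist_self]; lia)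
  have hu : c (u, t') = c (s, t) := by
    have := h.color_eq_of_dist_right_eq (v := (u, t')) (by simp only [hdist, T'.dist_self]; lia)
    have := h.color_eq_of_dist_left_le (v := (u, t')) (by simp only [hdist]; lia)
    grind [h.color_ne, h.ne_right]
  have fibre : GoodPair (T □ T') c k ω (s', t') (u, t') :=
    h.symm.of_color_eq hu (by simp only [hdist, T'.dist_self]; lia) hw
      (boxProd_adj_left.mpr (dist_eq_one_iff_adj.mp hwu))
      (by simp only [hdist, T'.dist_self]; lia)
  exact fibre.snd_ne hT hT' rfl

theorem of_fst_equidistant [Nontrivial W] (hT : T.IsTree) (hT' : T'.IsTree)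
    (h : GoodPair (T □ T') c k ω (s, t) (s', t')) (hx : T.dist s x = T.dist s s') :
    GoodPair (T □ T') c k ω (s, t) (x, t') := by
  obtain rfl | hxs' := eq_or_ne s' x
  · exact h
  have hdist := dist_boxProd hT.connected hT'.connected
  have := h.dist_add_dist hT hT'
  have := h.dist_le_of_equidistant hT hT' hx
  have := hT.connected.pos_dist_of_ne hxs'
  obtain ⟨w, hs'w, hwx⟩ := exists_dist_eq_of_dist_eq_add hT.connected (x := s') (y := x)
    (i := T.dist s' x - 1) (j := 1) (by lia)
  have := T.dist_comm (u := s') (v := w)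
  have := T.dist_comm (u := s') (v := x)
  obtain ⟨m, hm⟩ := even_dist_of_equidistant hT hx
  have := dist_of_equidistant hT hx (y := w) (by lia) (by lia)
  have hw : c (w, t') = ω := h.color_eq_of_dist_le_of_dist_le
    (by simp only [hdist]; lia) (by simp only [hdist, T'.dist_self]; lia)
  have hrx : (T □ T').dist (s, t) (x, t') = k + 1 := by simp only [hdist]; lia
  have hcx : c (x, t') = c (s', t') := by
    have := h.color_eq_of_dist_right_le (v := (x, t')) (by simp only [hdist, T'.dist_self]; lia)
    have := h.color_eq_of_dist_left_eq hrx
    grind [h.ne_left]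
  exact h.of_color_eq hcx hrx hw (boxProd_adj_left.mpr (dist_eq_one_iff_adj.mp hwx))
    (by simp only [hdist]; lia)

theorem of_snd_equidistant [Nontrivial V] (hT : T.IsTree) (hT' : T'.IsTree)
    (h : GoodPair (T □ T') c k ω (s, t) (s', t')) (hy : T'.dist t y = T'.dist t t') :
    GoodPair (T □ T') c k ω (s, t) (s', y) :=
  (h.swap.of_fst_equidistant hT' hT hy).swap

variable [Nontrivial V] [Nontrivial W]

theorem of_dist_le (hT : T.IsTree) (hT' : T'.IsTree)
    (h : GoodPair (T □ T') c k ω (s, t) (s', t')) (hle : T.dist s s' ≤ T.dist s x)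
    (hxy : T.dist s x + T'.dist t y = k + 1) : GoodPair (T □ T') c k ω (s, t) (x, y) := by
  obtain ⟨n, hn⟩ := Nat.exists_eq_add_of_le hle
  induction n generalizing s' t' with
  | zero =>
    have := h.dist_add_dist hT hT'
    exact (h.of_fst_equidistant hT hT' hn).of_snd_equidistant hT hT' (by lia)
  | succ n ih =>
    have hdist := dist_boxProd hT.connected hT'.connected
    have := h.dist_add_dist hT hT'
    obtain ⟨s₂, hss₂, _⟩ := exists_dist_eq_of_dist_eq_add hT.connected
      (i := T.dist s s' + 1) (j := n) (hn.trans (by lia))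
    obtain ⟨s₁, hss₁, hs₁s₂⟩ := exists_dist_eq_of_dist_eq_add hT.connected hss₂
    obtain ⟨t₁, htt₁, ht₁t'⟩ := exists_dist_eq_of_dist_eq_add hT'.connected (x := t) (y := t')
      (i := T'.dist t t' - 1) (j := 1) (by lia)
    have hs₂t₁ : GoodPair (T □ T') c k ω (s, t) (s₂, t₁) :=
      (h.of_fst_equidistant hT hT' hss₁).of_common_neighbor (w := (s₁, t₁))
        (by simp only [hdist]; lia) (boxProd_adj_right.mpr (dist_eq_one_iff_adj.mp ht₁t'))
        (boxProd_adj_left.mpr (dist_eq_one_iff_adj.mp hs₁s₂)) (by simp only [hdist]; lia)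
    exact ih hs₂t₁ (by lia) (by lia)

theorem of_dist_left_eq (hT : T.IsTree) (hT' : T'.IsTree)
    (h : GoodPair (T □ T') c k ω (s, t) (s', t')) (hxy : T.dist s x + T'.dist t y = k + 1) :
    GoodPair (T □ T') c k ω (s, t) (x, y) := by
  have := h.dist_add_dist hT hT'
  rcases le_total (T.dist s s') (T.dist s x) with hle | hle
  · exact h.of_dist_le hT hT' hle hxy
  · exact (h.swap.of_dist_le hT' hT (by lia) (by lia)).swap

theorem dist_snd_le (hT : T.IsTree) (hT' : T'.IsTree)
    (h : GoodPair (T □ T') c k ω (s, t) (s', t')) (y : W) : T'.dist t y ≤ k := by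
  by_contra! hlt
  obtain ⟨z, hz, -⟩ := exists_dist_eq_of_le hT'.connected hlt.nat_succ_le
  exact (h.of_dist_left_eq hT hT' (x := s) (y := z) (by simp [hz])).fst_ne hT hT' rfl

theorem dist_fst_le (hT : T.IsTree) (hT' : T'.IsTree)
    (h : GoodPair (T □ T') c k ω (s, t) (s', t')) (x : V) : T.dist s x ≤ k :=
  h.swap.dist_snd_le hT' hT x

theorem exists_of_fst (hT : T.IsTree) (hT' : T'.IsTree)
    (h : GoodPair (T □ T') c k ω (s, t) (s', t')) (hle : T.dist s s' ≤ T.dist s x) :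
    ∃ y, GoodPair (T □ T') c k ω (s, t) (x, y) := by
  have := h.dist_add_dist hT hT'
  have := h.dist_fst_le hT hT' x
  obtain ⟨y, hy, -⟩ := exists_dist_eq_of_le hT'.connected (x := t) (y := t')
    (i := k + 1 - T.dist s x) (by lia)
  exact ⟨y, h.of_dist_left_eq hT hT' (by lia)⟩

theorem color_eq_or_eq_or_eq (hT : T.IsTree) (hT' : T'.IsTree) {r b : V × W}
    (h : GoodPair (T □ T') c k ω r b) (v : V × W) : c v = ω ∨ c v = c r ∨ c v = c b := by
  obtain ⟨s, t⟩ := r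
  obtain ⟨s', t'⟩ := b
  obtain ⟨x, y⟩ := v
  have hdist := dist_boxProd hT.connected hT'.connected
  have := h.dist_fst_le hT hT' x
  by_cases hv : (T □ T').dist (s, t) (x, y) ≤ k
  · have := h.color_eq_of_dist_left_le hv
    tauto
  · simp only [hdist] at hv
    obtain ⟨z, htz, -⟩ := exists_dist_eq_of_le hT'.connected (x := t) (y := y)
      (i := k + 1 - T.dist s x) (by lia)
    have hz := h.of_dist_left_eq hT hT' (x := x) (y := z) (by lia)
    have hle := hz.symm.dist_snd_le hT hT' y
    have := hz.color_eq_of_dist_right_le (v := (x, y))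
      (by simpa [hdist, T'.dist_comm] using hle)
    have := h.color_eq_of_goodPair hz
    grind

theorem exists_dist_fst_eq_diam [Finite V] (hT : T.IsTree) (hT' : T'.IsTree) {r b : V × W}
    (h : GoodPair (T □ T') c k ω r b) :
    ∃ s s' t t', GoodPair (T □ T') c k ω (s, t) (s', t') ∧ T.dist s s' = T.diam := by
  obtain ⟨s, t⟩ := r
  obtain ⟨s', t'⟩ := b
  obtain ⟨x, farthest⟩ := Finite.exists_max (T.dist s)
  obtain ⟨x', hxx'⟩ := exists_dist_eq_diam_of_farthest hT farthest
  obtain ⟨y, hy⟩ := h.exists_of_fst hT hT' (farthest s')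
  obtain ⟨y', hy'⟩ := hy.symm.exists_of_fst hT hT' (x := x')
    (hxx' ▸ dist_le_diam_of_connected hT.connected x s)
  exact ⟨x, x', y, y', hy', hxx'⟩

end GoodPair

end ProductOfTrees

/-! ### Rainbow-free colorings with at least three colors: necessary conditions -/

/-- A diametral pair of vertices such that all vertices at distance `T.diam` from `s'` are close to
`s`, and all vertices at distance `T.diam - 1` from `s` are close to `s'`. If `T.diam + T'.diam` is
even, then a rainbow-free coloring of `T □ T'` with three colors requires such a pair in both
factors. -/
structure IsSlimPair {V : Type*} (T : SimpleGraph V) (s s' : V) : Prop where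
  dist_eq : T.dist s s' = T.diam
  near_left : ∀ a, T.dist a s' = T.diam → T.dist a s + 2 ≤ T.diam
  near_right : ∀ a, T.dist a s + 1 = T.diam → T.dist a s' + 2 ≤ T.diam

section Necessity

variable {V W κ : Type*} {T : SimpleGraph V} {T' : SimpleGraph W} {c : V × W → κ} {k : ℕ} {ω : κ}
  {s s' x : V} {t t' u y : W}

theorem exists_dist_eq_diam_of_isNPeripheral [Finite V] (hT : T.IsTree) (h : T.IsNPeripheral 3)
    (hss' : T.dist s s' = T.diam) : ∃ x, T.dist x s = T.diam ∧ T.dist x s' = T.diam := by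
  obtain ⟨p, -, hp⟩ := h
  have h01 := hp 0 1 (by decide)
  have h02 := hp 0 2 (by decide)
  have h12 := hp 1 2 (by decide)
  have hle := dist_le_diam_of_connected hT.connected
  have := dist_add_dist_le_max hT (p 0) (p 1) s s'
  have := dist_add_dist_le_max hT (p 0) (p 2) s s'
  have := dist_add_dist_le_max hT (p 1) (p 2) s s'
  by_contra! hne
  grind

namespace GoodPair

variable [Nontrivial V] [Nontrivial W]

theorem dist_add_dist_ne (hT : T.IsTree) (hT' : T'.IsTree)
    (h : GoodPair (T □ T') c k ω (s, t) (s', t')) (hx : T.dist x s' = T.dist s s') :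
    T.dist s x + T'.dist t y ≠ k + 1 := by
  intro hxy
  have hadd := h.dist_add_dist hT hT'
  have hcx : c (x, t) = c (s, t) := h.symm.color_eq_of_goodPair
    (h.symm.of_dist_left_eq hT hT' (by rwa [T.dist_comm, hx, T'.dist_comm]))
  have hgood := h.of_dist_left_eq hT hT' hxy
  have := hT.connected.pos_dist_of_ne (hgood.fst_ne hT hT')
  have hlt := hgood.lt_dist_right_of_color_eq hcx
  simp only [dist_boxProd hT.connected hT'.connected, T.dist_self] at hlt
  lia

theorem isSlimPair [Finite V] (hT : T.IsTree) (hT' : T'.IsTree)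
    (h : GoodPair (T □ T') c k ω (s, t) (s', t')) (hss' : T.dist s s' = T.diam)
    (hu : T'.dist t u = T'.dist t t' + 1) : IsSlimPair T s s' := by
  have hle := dist_le_diam_of_connected hT.connected
  have hadd := h.dist_add_dist hT hT'
  have near_left (a : V) (ha : T.dist a s' = T.diam) : T.dist a s + 2 ≤ T.diam := by
    have := hle s a
    have := h.dist_add_dist_ne hT hT' (x := a) (y := t') (ha.trans hss'.symm)
    have := h.dist_add_dist_ne hT hT' (x := a) (y := u) (ha.trans hss'.symm)
    have := T.dist_comm (u := a) (v := s)
    lia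
  refine ⟨hss', near_left, fun a ha => ?_⟩
  by_contra! hlt
  have has' : T.dist a s' + 1 = T.diam := by
    have := hle a s'
    have := near_left a
    lia
  have hau : GoodPair (T □ T') c k ω (s, t) (a, u) :=
    h.of_dist_left_eq hT hT' (by rw [T.dist_comm]; lia)
  have hcs' : c (s', t) = c (s, t) := hau.symm.color_eq_of_goodPair
    (hau.symm.of_dist_left_eq hT hT' (by rw [T'.dist_comm]; lia))
  have hlt' := h.lt_dist_right_of_color_eq hcs'
  have := near_left s hss'
  simp only [dist_boxProd hT.connected hT'.connected, T.dist_self] at hlt'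
  lia

end GoodPair

variable [Finite V] [Nontrivial V] [Nontrivial W]

theorem RainbowFree.not_isNPeripheral (hT : T.IsTree) (hT' : T'.IsTree)
    (hc : RainbowFree (T □ T') c) {p q r : V × W} (hpq : c p ≠ c q) (hpr : c p ≠ c r)
    (hqr : c q ≠ c r) : ¬ T.IsNPeripheral 3 := by
  intro h3
  obtain ⟨k, ω, b, b', hb⟩ := exists_goodPair (hT.connected.boxProd hT'.connected)
    (colorable_boxProd hT.isBipartite hT'.isBipartite) hc hpq hpr hqr
  obtain ⟨s, s', t, t', h, hss'⟩ := hb.exists_dist_fst_eq_diam hT hT'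
  obtain ⟨x, hxs, hxs'⟩ := exists_dist_eq_diam_of_isNPeripheral hT h3 hss'
  refine h.dist_add_dist_ne hT hT' (y := t') (hxs'.trans hss'.symm) ?_
  rw [T.dist_comm, hxs, ← hss', h.dist_add_dist hT hT']

theorem RainbowFree.exists_isSlimPair [Finite W] (hT : T.IsTree) (hT' : T'.IsTree)
    (hc : RainbowFree (T □ T') c) {p q r : V × W} (hpq : c p ≠ c q) (hpr : c p ≠ c r)
    (hqr : c q ≠ c r) (heven : Even (T.diam + T'.diam)) : ∃ s s', IsSlimPair T s s' := by
  obtain ⟨k, ω, b, b', hb⟩ := exists_goodPair (hT.connected.boxProd hT'.connected)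
    (colorable_boxProd hT.isBipartite hT'.isBipartite) hc hpq hpr hqr
  obtain ⟨s, s', t, t', h, hss'⟩ := hb.exists_dist_fst_eq_diam hT hT'
  have hadd := h.dist_add_dist hT hT'
  obtain ⟨u, v, huv⟩ := T'.exists_dist_eq_diam
  -- `T.dist s s' + T'.dist t t' = k + 1` is odd, so `t` and `t'` are not diametral.
  have hlt : T'.dist t t' < T'.dist u v := by
    have := dist_le_diam_of_connected hT'.connected t t'
    have := h.even
    grind
  obtain ⟨z, hz | hz⟩ := exists_dist_eq_dist_add_one hT' hlt
  · exact ⟨s, s', h.isSlimPair hT hT' hss' hz⟩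
  · exact ⟨s', s, h.symm.isSlimPair hT hT' (T.dist_comm.trans hss') (by rw [hz, T'.dist_comm])⟩

end Necessity

/-! ### Constructions of rainbow-free colorings with three colors -/

section Spheres

variable {V : Type*} {G : SimpleGraph V} {m : ℕ} {R B : Set V}

theorem rainbowFree_of_spheres [DecidablePred (· ∈ R)] [DecidablePred (· ∈ B)] (hG : G.Connected)
    (hbip : G.IsBipartite) (hm : Odd m) (hR : ∀ r ∈ R, ∀ v, G.dist r v = m ↔ v ∈ B)
    (hB : ∀ b ∈ B, ∀ v, G.dist b v = m → v ∈ R) :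
    RainbowFree G (fun v => if v ∈ R then (0 : Fin 3) else if v ∈ B then 1 else 2) := by
  intro u v w _ h
  have huvw : G.dist u v = G.dist v w := congrArg ENat.toNat h
  have hdist {r b : V} (hr : r ∈ R) (hb : b ∈ B) : G.dist r b = m := (hR r hr b).mpr hb
  by_cases hv : v ∈ R ∨ v ∈ B
  · have hu : v ∈ R → (u ∈ B ↔ w ∈ B) := fun hv => by
      rw [← hR v hv, ← hR v hv, G.dist_comm, huvw]
    have hw : v ∈ B → (u ∈ R ↔ w ∈ R) := fun hv => by
      have mem_iff (x : V) : x ∈ R ↔ G.dist v x = m :=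
        ⟨fun hx => G.dist_comm.trans (hdist hx hv), hB v hv x⟩
      rw [mem_iff, mem_iff, G.dist_comm, huvw]
    grind
  · have hodd {r b : V} (hr : r ∈ R) (hb : b ∈ B) : G.dist r v ≠ G.dist v b := fun heq => by
      have := even_dist_add_dist_add_dist hG hbip r v b
      have := hdist hr hb
      grind
    have := @hodd u w
    have := @hodd w u
    grind [SimpleGraph.dist_comm]

theorem exists_rainbowFree_of_spheres (hG : G.Connected) (hbip : G.IsBipartite) (hm : Odd m)
    (hm₁ : m ≠ 1) (hRne : R.Nonempty) (hBne : B.Nonempty)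
    (hR : ∀ r ∈ R, ∀ v, G.dist r v = m ↔ v ∈ B) (hB : ∀ b ∈ B, ∀ v, G.dist b v = m → v ∈ R) :
    ∃ c : V → Fin 3, Function.Surjective c ∧ RainbowFree G c := by
  classical
  refine ⟨_, fun i => ?_, rainbowFree_of_spheres hG hbip hm hR hB⟩
  obtain ⟨r, hr⟩ := hRne
  obtain ⟨b, hb⟩ := hBne
  have hrb : G.dist r b = m := (hR r hr b).mpr hb
  have hbR : b ∉ R := fun hbR => by
    have := (hR b hbR b).mpr hb
    grind [G.dist_self]
  obtain ⟨n, rfl⟩ := hm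
  obtain ⟨z, hrz, hzb⟩ := exists_dist_eq_of_dist_eq_add hG (i := 1) (j := 2 * n)
    (hrb.trans (by lia))
  have hzR : z ∉ R := fun hz => by
    have := (hR z hz b).mpr hb
    lia
  have hzB : z ∉ B := fun hz => by
    have := (hR r hr z).mpr hz
    lia
  fin_cases i
  · exact ⟨r, by simp [hr]⟩
  · exact ⟨b, by simp [hb, hbR]⟩
  · exact ⟨z, by simp [hzR, hzB]⟩

end Spheres

section DiametralSpheres

variable {V : Type*} {T : SimpleGraph V} {s s' a x y z : V}

theorem dist_eq_dist_of_not_isNPeripheral [Finite V] [Nontrivial V] (hT : T.IsTree)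
    (h : ¬ T.IsNPeripheral 3) (hss' : T.dist s s' = T.diam) (ha : T.dist a s' = T.diam)
    (hx : T.dist a x = T.diam ∨ T.dist s x = T.diam) : T.dist a x = T.dist s x := by
  have hle := dist_le_diam_of_connected hT.connected
  have has : T.dist a s ≠ T.diam := fun has =>
    h ((isNPeripheral_three_iff (diam_ne_zero_of_connected hT.connected)).mpr
      ⟨a, s, s', has, hss', ha⟩)
  have := dist_add_dist_le_max hT a x s s'
  have := dist_add_dist_le_max hT s x a s'
  grind [SimpleGraph.dist_comm]

theorem dist_eq_diam_of_not_isNPeripheral [Finite V] [Nontrivial V] (hT : T.IsTree)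
    (h : ¬ T.IsNPeripheral 3) (hss' : T.dist s s' = T.diam) (hx : T.dist s x = T.diam)
    (hz : T.dist x z = T.diam) : T.dist z s' = T.diam := by
  have hle := dist_le_diam_of_connected hT.connected
  have := dist_add_dist_le_max hT x z s s'
  have hxs' : T.dist x s' ≠ T.diam := fun hxs' =>
    h ((isNPeripheral_three_iff (diam_ne_zero_of_connected hT.connected)).mpr
      ⟨s, x, s', hx, hxs', hss'⟩)
  grind [SimpleGraph.dist_comm]

namespace IsSlimPair

theorem two_le_diam (h : IsSlimPair T s s') : 2 ≤ T.diam := by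
  simpa using h.near_left s h.dist_eq

theorem not_isNPeripheral [Finite V] (hT : T.IsTree) (h : IsSlimPair T s s') :
    ¬ T.IsNPeripheral 3 := fun h3 => by
  obtain ⟨x, hxs, hxs'⟩ := exists_dist_eq_diam_of_isNPeripheral hT h3 h.dist_eq
  have := h.near_left x hxs'
  lia

variable [Finite V]

theorem dist_eq_dist (hT : T.IsTree) (h : IsSlimPair T s s') (ha : T.dist a s' = T.diam)
    (hx : T.diam ≤ T.dist a x + 1 ∨ T.diam ≤ T.dist s x + 1) : T.dist a x = T.dist s x := by
  have hle := dist_le_diam_of_connected hT.connected x s'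
  have := dist_add_dist_le_max hT a x s s'
  have := dist_add_dist_le_max hT s x a s'
  grind [h.dist_eq, h.near_left a ha, SimpleGraph.dist_comm]

theorem dist_add_one_le (hT : T.IsTree) (h : IsSlimPair T s s') (hy : T.dist s y + 1 = T.diam)
    (z : V) : T.dist y z + 1 ≤ T.diam := by
  have hle := dist_le_diam_of_connected hT.connected
  have := dist_add_dist_le_max hT y z s s'
  have := h.near_right y (T.dist_comm (u := y) ▸ hy)
  grind [h.dist_eq, SimpleGraph.dist_comm]

theorem dist_eq_diam (hT : T.IsTree) (h : IsSlimPair T s s') (hy : T.dist s y + 1 = T.diam)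
    (hz : T.dist y z + 1 = T.diam) : T.dist z s' = T.diam := by
  have hle := dist_le_diam_of_connected hT.connected
  have := dist_add_dist_le_max hT y z s s'
  have := h.near_right y (T.dist_comm (u := y) ▸ hy)
  grind [h.dist_eq, SimpleGraph.dist_comm]

end IsSlimPair

end DiametralSpheres

section Sufficiency

variable {V W : Type*} [Finite V] [Finite W] [Nontrivial V] [Nontrivial W] {T : SimpleGraph V}
  {T' : SimpleGraph W} {s s' : V} {t t' : W}

theorem IsSlimPair.exists_rainbowFree (hT : T.IsTree) (hT' : T'.IsTree) (h : IsSlimPair T s s')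
    (h' : IsSlimPair T' t t') (heven : Even (T.diam + T'.diam)) :
    ∃ c : V × W → Fin 3, Function.Surjective c ∧ RainbowFree (T □ T') c := by
  have hdist := dist_boxProd hT.connected hT'.connected
  have hle := dist_le_diam_of_connected hT.connected
  have hle' := dist_le_diam_of_connected hT'.connected
  have hG := hT.connected.boxProd hT'.connected
  have := h.two_le_diam
  have := h'.two_le_diam
  have := h.dist_eq
  have := h'.dist_eq
  refine exists_rainbowFree_of_spheres hG (colorable_boxProd hT.isBipartite hT'.isBipartite)
    (m := T.diam + T'.diam - 1) (R := {v | T.dist v.1 s' = T.diam ∧ T'.dist v.2 t' = T'.diam})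
    (B := {v | (T □ T').dist (s, t) v = T.diam + T'.diam - 1}) (by grind) (by lia)
    ⟨(s, t), h.dist_eq, h'.dist_eq⟩ ?_ ?_ ?_
  · obtain ⟨b, hb, -⟩ := exists_dist_eq_of_le hG (x := (s, t)) (y := (s', t'))
      (i := T.diam + T'.diam - 1) (by simp only [hdist]; lia)
    exact ⟨b, hb⟩
  · rintro ⟨a, a'⟩ ⟨ha, ha'⟩ ⟨x, y⟩
    have := h.dist_eq_dist hT ha (x := x)
    have := h'.dist_eq_dist hT' ha' (x := y)
    grind
  · rintro ⟨x, y⟩ hxy ⟨x', y'⟩ hv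
    simp only [Set.mem_ofPred_eq, hdist] at hxy hv ⊢
    have hx := dist_eq_diam_of_not_isNPeripheral hT (h.not_isNPeripheral hT) h.dist_eq
      (x := x) (z := x')
    have hy := dist_eq_diam_of_not_isNPeripheral hT' (h'.not_isNPeripheral hT') h'.dist_eq
      (x := y) (z := y')
    have hx₁ := h.dist_add_one_le hT (y := x)
    have hy₁ := h'.dist_add_one_le hT' (y := y)
    have := h.dist_eq_diam hT (y := x) (z := x')
    have := h'.dist_eq_diam hT' (y := y) (z := y')
    grind

theorem exists_rainbowFree_of_odd (hT : T.IsTree) (hT' : T'.IsTree)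
    (hodd : Odd (T.diam + T'.diam)) (h : ¬ T.IsNPeripheral 3) (h' : ¬ T'.IsNPeripheral 3) :
    ∃ c : V × W → Fin 3, Function.Surjective c ∧ RainbowFree (T □ T') c := by
  have hdist := dist_boxProd hT.connected hT'.connected
  have hle := dist_le_diam_of_connected hT.connected
  have hle' := dist_le_diam_of_connected hT'.connected
  have := diam_ne_zero_of_connected hT.connected
  have := diam_ne_zero_of_connected hT'.connected
  obtain ⟨s, s', hss'⟩ := T.exists_dist_eq_diam
  obtain ⟨t, t', htt'⟩ := T'.exists_dist_eq_diam
  refine exists_rainbowFree_of_spheres (hT.connected.boxProd hT'.connected)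
    (colorable_boxProd hT.isBipartite hT'.isBipartite)
    (R := {v | T.dist v.1 s' = T.diam ∧ T'.dist v.2 t' = T'.diam})
    (B := {v | (T □ T').dist (s, t) v = T.diam + T'.diam}) hodd (by lia) ⟨(s, t), hss', htt'⟩
    ⟨(s', t'), by simp [hdist, hss', htt']⟩ ?_ ?_
  · rintro ⟨a, a'⟩ ⟨ha, ha'⟩ ⟨x, y⟩
    have := dist_eq_dist_of_not_isNPeripheral hT h hss' ha (x := x)
    have := dist_eq_dist_of_not_isNPeripheral hT' h' htt' ha' (x := y)
    grind
  · rintro ⟨x, y⟩ hxy ⟨x', y'⟩ hv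
    have := dist_eq_diam_of_not_isNPeripheral hT h hss' (x := x) (z := x')
    have := dist_eq_diam_of_not_isNPeripheral hT' h' htt' (x := y) (z := y')
    grind

end Sufficiency

/-! ### Slim pairs and weakly non-3-peripheral trees -/

section Diameter

variable {V : Type*} {G : SimpleGraph V}

theorem diam_eq_of_forall_dist_le [Finite V] (hG : G.Connected) {u v : V}
    (h : ∀ x y, G.dist x y ≤ G.dist u v) : G.diam = G.dist u v := by
  have := hG.nonempty
  obtain ⟨x, y, hxy⟩ := G.exists_dist_eq_diam
  exact (hxy ▸ h x y).antisymm (dist_le_diam_of_connected hG u v)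

theorem isPeripheral_iff [Finite V] (hG : G.Connected) {s : V} :
    G.IsPeripheral s ↔ ∃ s', G.dist s s' = G.diam := by
  have := hG.nonempty
  have hdiam : (G.diam : ℕ∞) = G.ediam :=
    ENat.natCast_toNat (connected_iff_ediam_ne_top.mp hG)
  have hdist (x y : V) : (G.dist x y : ℕ∞) = G.edist x y := (hG x y).coe_dist_eq_edist
  constructor
  · intro h
    obtain ⟨s', hs'⟩ := G.exists_edist_eq_eccent_of_finite s
    exact ⟨s', by exact_mod_cast (hdist s s').trans (hs'.trans (h.trans hdiam.symm))⟩
  · rintro ⟨s', hs'⟩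
    refine eccent_le_ediam.antisymm ?_
    rw [← hdiam, ← hs', hdist]
    exact edist_le_eccent

theorem nonempty_iso_pathGraph_two_iff [Nontrivial V] (hbip : G.IsBipartite) :
    Nonempty (G ≃g pathGraph 2) ↔ G.diam = 1 := by
  rw [diam_eq_one, pathGraph_two_eq_top]
  constructor
  · rintro ⟨φ⟩
    ext u v
    rw [← φ.map_adj_iff, top_adj, top_adj, φ.injective.ne_iff]
  · rintro rfl
    obtain ⟨C⟩ := hbip
    have hinj : Function.Injective C := Hom.injective_of_top_hom C
    have hcard : Nat.card V = 2 :=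
      le_antisymm (by simpa using Nat.card_le_card_of_injective C hinj)
        (have := Finite.of_injective C hinj; Finite.one_lt_card)
    have := Finite.of_injective C hinj
    exact ⟨Iso.completeGraph (Finite.equivFinOfCardEq hcard)⟩

end Diameter

section RemoveDiametral

variable {V : Type*} {G T : SimpleGraph V} {s s' : V}

theorem exists_walk_induce_of_convex (hG : G.Connected) {A : Set V}
    (hA : ∀ x ∈ A, ∀ y ∈ A, ∀ z, G.dist x z + G.dist z y = G.dist x y → z ∈ A) (x y : A) :
    ∃ p : (G.induce A).Walk x y, p.length = G.dist x y := by
  obtain ⟨p, hp⟩ := hG.exists_walk_length_eq_dist x y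
  have hsupp (z : V) (hz : z ∈ p.support) : z ∈ A := by
    obtain ⟨q, r, rfl⟩ := Walk.mem_support_iff_exists_append.mp hz
    refine hA x x.2 y y.2 z (le_antisymm ?_ hG.dist_triangle)
    rw [← hp, Walk.length_append]
    exact add_le_add (dist_le q) (dist_le r)
  refine ⟨p.induce A hsupp, ?_⟩
  rw [← hp, ← Walk.length_map (Embedding.induce A).toHom, Walk.map_induce]
  rfl

theorem dist_induce_of_convex (hG : G.Connected) {A : Set V}
    (hA : ∀ x ∈ A, ∀ y ∈ A, ∀ z, G.dist x z + G.dist z y = G.dist x y → z ∈ A) (x y : A) :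
    (G.induce A).dist x y = G.dist x y := by
  obtain ⟨p, hp⟩ := exists_walk_induce_of_convex hG hA x y
  refine le_antisymm (hp ▸ dist_le p) ?_
  obtain ⟨q, hq⟩ := p.reachable.exists_walk_length_eq_dist
  rw [← hq, ← Walk.length_map (Embedding.induce A).toHom]
  exact dist_le _

variable [Finite V]

theorem dist_ne_diam_of_convex (hT : T.IsTree) (s x : V) (hx : T.dist s x ≠ T.diam) (y : V)
    (hy : T.dist s y ≠ T.diam) (z : V) (hz : T.dist x z + T.dist z y = T.dist x y) :
    T.dist s z ≠ T.diam := by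
  have := dist_le_diam_of_connected hT.connected s x
  have := dist_le_diam_of_connected hT.connected s y
  have := dist_add_dist_le_max hT s z x y
  grind [SimpleGraph.dist_comm]

theorem dist_removeDiametral (hT : T.IsTree) (s : V) (x y : {w : V // T.dist s w ≠ T.diam}) :
    (T.removeDiametral s).dist x y = T.dist x y :=
  dist_induce_of_convex hT.connected (dist_ne_diam_of_convex hT s) x y

variable [Nontrivial V]

theorem isTree_removeDiametral (hT : T.IsTree) (s : V) : (T.removeDiametral s).IsTree where
  connected := by
    have : Nonempty {w : V // T.dist s w ≠ T.diam} :=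
      ⟨s, T.dist_self ▸ (diam_ne_zero_of_connected hT.connected).symm⟩
    exact ⟨fun x y => (exists_walk_induce_of_convex hT.connected
      (dist_ne_diam_of_convex hT s) x y).choose.reachable⟩
  isAcyclic := hT.isAcyclic.of_comap (Function.Embedding.subtype _)

theorem diam_removeDiametral (hT : T.IsTree) (hss' : T.dist s s' = T.diam) :
    (T.removeDiametral s).diam + 1 = T.diam := by
  have hle := dist_le_diam_of_connected hT.connected
  have := diam_ne_zero_of_connected hT.connected
  obtain ⟨z, hsz, -⟩ := exists_dist_eq_of_le hT.connected (x := s) (y := s') (i := T.diam - 1)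
    (by lia)
  have hdiam := diam_eq_of_forall_dist_le (isTree_removeDiametral hT s).connected
    (u := ⟨s, by simp; lia⟩) (v := ⟨z, by lia⟩) fun ⟨x, hx⟩ ⟨y, hy⟩ => by
      have := dist_add_dist_le_max hT x y s s'
      simp only [dist_removeDiametral hT]
      grind [SimpleGraph.dist_comm]
  rw [dist_removeDiametral hT] at hdiam
  lia

theorem IsSlimPair.not_isNPeripheral_removeDiametral (hT : T.IsTree) (h : IsSlimPair T s s') :
    ¬ (T.removeDiametral s).IsNPeripheral 3 := by
  intro h3
  have := h.two_le_diam
  have hdiam := diam_removeDiametral hT h.dist_eq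
  obtain ⟨z, hsz, hzs'⟩ := exists_dist_eq_of_dist_eq_add hT.connected (i := T.diam - 1) (j := 1)
    (h.dist_eq.trans (by lia))
  obtain ⟨⟨x, hx⟩, hxs, hxz⟩ := exists_dist_eq_diam_of_isNPeripheral
    (isTree_removeDiametral hT s) h3 (s := ⟨s, by simp; lia⟩) (s' := ⟨z, by lia⟩)
    (by simp only [dist_removeDiametral hT]; lia)
  simp only [dist_removeDiametral hT] at hxs hxz
  have := h.near_right x (by lia)
  have := dist_add_dist_le_max hT s s' z x
  grind [h.dist_eq, SimpleGraph.dist_comm]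

theorem isSlimPair_of_odd (hT : T.IsTree) (hodd : Odd T.diam) (hne : T.diam ≠ 1)
    (hss' : T.dist s s' = T.diam) (h3 : ¬ (T.removeDiametral s).IsNPeripheral 3) :
    IsSlimPair T s s' := by
  have heven := even_dist_add_dist_add_dist hT.connected hT.isBipartite
  have hle := dist_le_diam_of_connected hT.connected
  have hdiam := diam_removeDiametral hT hss'
  have near_left (a : V) (ha : T.dist a s' = T.diam) : T.dist a s + 2 ≤ T.diam := by
    by_contra! hlt
    obtain ⟨z, hsz, hzs'⟩ := exists_dist_eq_of_dist_eq_add hT.connected (i := T.diam - 1) (j := 1)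
      (hss'.trans (by lia))
    have has : T.dist a s = T.diam - 1 := by
      have := heven a s s'
      grind
    have haz : T.dist a z = T.diam - 1 := by
      have := hT.connected.dist_triangle (u := a) (v := z) (w := s')
      have := heven a z s'
      grind
    refine h3 ((isNPeripheral_three_iff (by lia)).mpr
      ⟨⟨s, by simp; lia⟩, ⟨a, by rw [T.dist_comm]; lia⟩, ⟨z, by lia⟩, ?_, ?_, ?_⟩) <;>
      simp only [dist_removeDiametral hT] <;> grind [SimpleGraph.dist_comm]
  refine ⟨hss', near_left, fun a ha => ?_⟩
  have := near_left a
  have := heven a s s'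
  grind

end RemoveDiametral

section AddLeaf

variable {V : Type*} {G T : SimpleGraph V} {s s' u v : V}

theorem addLeaf_adj_some_some : (G.addLeaf u).Adj (some s) (some v) ↔ G.Adj s v := by
  rw [addLeaf, sup_adj, edge_adj, map_adj]
  simp

theorem addLeaf_adj_none_some : (G.addLeaf u).Adj none (some v) ↔ v = u := by
  rw [addLeaf, sup_adj, edge_adj, map_adj]
  simp

theorem le_dist_of_forall_adj (hG : G.Connected) {f : V → ℕ} (hf : ∀ x y, G.Adj x y → f y ≤ f x + 1)
    (x y : V) : f y ≤ f x + G.dist x y := by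
  obtain ⟨p, hp⟩ := hG.exists_walk_length_eq_dist x y
  rw [← hp]
  clear hp
  induction p with
  | nil => simp
  | cons hadj p ih =>
    have := hf _ _ hadj
    rw [Walk.length_cons]
    lia

/-- The inclusion of a graph into the graph with an added leaf. -/
def homAddLeaf (G : SimpleGraph V) (u : V) : G →g G.addLeaf u where
  toFun := some
  map_rel' := addLeaf_adj_some_some.mpr

theorem connected_addLeaf (hG : G.Connected) (u : V) : (G.addLeaf u).Connected := by
  have hreach (x : Option V) : (G.addLeaf u).Reachable (some u) x := by
    cases x with
    | none => exact (addLeaf_adj_none_some.mpr rfl).symm.reachable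
    | some v => exact (hG u v).map (homAddLeaf G u)
  exact ⟨fun x y => (hreach x).symm.trans (hreach y)⟩

theorem elim_dist_le_dist_addLeaf (hG : G.Connected) (u v : V) (x : Option V) :
    x.elim (G.dist v u + 1) (G.dist v) ≤ (G.addLeaf u).dist (some v) x := by
  have hstep (x y : Option V) (hxy : (G.addLeaf u).Adj x y) :
      y.elim (G.dist v u + 1) (G.dist v) ≤ x.elim (G.dist v u + 1) (G.dist v) + 1 := by
    match x, y with
    | none, none => simp
    | none, some y =>
      obtain rfl := addLeaf_adj_none_some.mp hxy
      simp [Option.elim]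
      lia
    | some x, none =>
      obtain rfl := addLeaf_adj_none_some.mp hxy.symm
      simp [Option.elim]
    | some x, some y =>
      have := dist_eq_one_iff_adj.mpr (addLeaf_adj_some_some.mp hxy)
      exact this ▸ hG.dist_triangle (u := v) (v := x) (w := y)
  simpa using le_dist_of_forall_adj (connected_addLeaf hG u) hstep (some v) x

theorem dist_addLeaf_some_some (hG : G.Connected) (u v w : V) :
    (G.addLeaf u).dist (some v) (some w) = G.dist v w := by
  refine le_antisymm ?_ (elim_dist_le_dist_addLeaf hG u v (some w))
  obtain ⟨p, hp⟩ := hG.exists_walk_length_eq_dist v w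
  rw [← hp, ← Walk.length_map (homAddLeaf G u)]
  exact dist_le _

theorem dist_addLeaf_none_some (hG : G.Connected) (u v : V) :
    (G.addLeaf u).dist none (some v) = G.dist u v + 1 := by
  rw [SimpleGraph.dist_comm, G.dist_comm]
  refine le_antisymm ?_ (elim_dist_le_dist_addLeaf hG u v none)
  have hu : (G.addLeaf u).dist (some u) none = 1 :=
    dist_eq_one_iff_adj.mpr (addLeaf_adj_none_some.mpr rfl).symm
  rw [← hu, ← dist_addLeaf_some_some hG u]
  exact (connected_addLeaf hG u).dist_triangle

theorem dist_addLeaf_some_none (hG : G.Connected) (u v : V) :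
    (G.addLeaf u).dist (some v) none = G.dist u v + 1 :=
  SimpleGraph.dist_comm.trans (dist_addLeaf_none_some hG u v)

variable [Finite V]

theorem diam_addLeaf (hT : T.IsTree) (hss' : T.dist s s' = T.diam)
    (hs : T.dist u s + 1 = T.diam) (hs' : T.dist u s' + 1 = T.diam) :
    (T.addLeaf u).diam = T.diam := by
  have hle := dist_le_diam_of_connected hT.connected
  have hlt (x : V) : T.dist u x + 1 ≤ T.diam := by
    have := dist_add_dist_le_max hT u x s s'
    grind
  rw [← hss', ← dist_addLeaf_some_some hT.connected u]
  refine diam_eq_of_forall_dist_le (connected_addLeaf hT.connected u) fun x y => ?_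
  rcases x with _ | x <;> rcases y with _ | y <;>
    simp only [dist_addLeaf_some_some hT.connected, dist_addLeaf_none_some hT.connected,
      dist_addLeaf_some_none hT.connected, SimpleGraph.dist_self] <;>
    grind

variable [Nontrivial V]

theorem exists_dist_eq_diam_of_isNPeripheral_addLeaf (hG : G.Connected) (h3 : ¬ G.IsNPeripheral 3)
    (h : (G.addLeaf u).IsNPeripheral 3) :
    ∃ a b, G.dist a b = G.diam ∧ G.dist u a + 1 = G.diam ∧ G.dist u b + 1 = G.diam := by
  have hconn := connected_addLeaf hG u
  have hle := dist_le_diam_of_connected hG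
  have hdiam : G.diam ≤ (G.addLeaf u).diam := by
    obtain ⟨x, y, hxy⟩ := G.exists_dist_eq_diam
    rw [← hxy, ← dist_addLeaf_some_some hG u]
    exact dist_le_diam_of_connected hconn _ _
  have hpos := diam_ne_zero_of_connected hG
  rw [isNPeripheral_three_iff hpos] at h3
  obtain ⟨x, y, z, hxy, hyz, hxz⟩ :=
    (isNPeripheral_three_iff (diam_ne_zero_of_connected hconn)).mp h
  rcases x with _ | x <;> rcases y with _ | y <;> rcases z with _ | z <;>
    simp only [dist_addLeaf_some_some hG, dist_addLeaf_none_some hG, dist_addLeaf_some_none hG,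
      SimpleGraph.dist_self] at hxy hyz hxz <;>
    grind

theorem isNPeripheral_addLeaf (hT : T.IsTree) (hss' : T.dist s s' = T.diam)
    (hs : T.dist u s + 1 = T.diam) (hs' : T.dist u s' + 1 = T.diam) :
    (T.addLeaf u).IsNPeripheral 3 := by
  have hdiam := diam_addLeaf hT hss' hs hs'
  refine (isNPeripheral_three_iff
    (hdiam ▸ diam_ne_zero_of_connected hT.connected)).mpr ⟨none, some s, some s', ?_⟩
  simp only [dist_addLeaf_some_some hT.connected, dist_addLeaf_none_some hT.connected]
  lia

theorem IsSlimPair.dist_add_one_ne_diam (hT : T.IsTree) (h : IsSlimPair T s s')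
    (heven : Even T.diam) {a b : V} (has' : T.dist a s' = T.diam) (hbs : T.dist b s = T.diam)
    (hua : T.dist u a + 1 = T.diam) : T.dist u b + 1 ≠ T.diam := by
  intro hub
  have hle := dist_le_diam_of_connected hT.connected
  have hparity := even_dist_add_dist_add_dist hT.connected hT.isBipartite
  have := h.dist_eq
  have := h.near_left a has'
  have := h.near_right u
  have hbs' : T.dist b s' ≠ T.diam := fun hbs' =>
    h.not_isNPeripheral hT ((isNPeripheral_three_iff
      (diam_ne_zero_of_connected hT.connected)).mpr ⟨b, s, s', hbs, h.dist_eq, hbs'⟩)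
  have := dist_add_dist_le_max hT a u s s'
  have := dist_add_dist_le_max hT b u s s'
  have := hparity b s s'
  have := hparity a s' u
  have := hparity b s u
  grind [SimpleGraph.dist_comm]

theorem IsSlimPair.not_isNPeripheral_addLeaf (hT : T.IsTree) (h : IsSlimPair T s s')
    (heven : Even T.diam) : ¬ (T.addLeaf u).IsNPeripheral 3 := by
  intro h3
  obtain ⟨a, b, hab, hua, hub⟩ := exists_dist_eq_diam_of_isNPeripheral_addLeaf hT.connected
    (h.not_isNPeripheral hT) h3
  have hle := dist_le_diam_of_connected hT.connected
  have hcases : T.dist a s' = T.diam ∧ T.dist b s = T.diam ∨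
      T.dist b s' = T.diam ∧ T.dist a s = T.diam := by
    have := dist_add_dist_le_max hT a b s s'
    have := h.dist_eq
    grind
  obtain ⟨has', hbs⟩ | ⟨hbs', has⟩ := hcases
  · exact h.dist_add_one_ne_diam hT heven has' hbs hua hub
  · exact h.dist_add_one_ne_diam hT heven hbs' has hub hua

theorem isSlimPair_of_even (hT : T.IsTree) (heven : Even T.diam) (h3 : ¬ T.IsNPeripheral 3)
    (hleaf : ∀ u, ¬ (T.addLeaf u).IsNPeripheral 3) (hss' : T.dist s s' = T.diam) :
    IsSlimPair T s s' := by
  have hle := dist_le_diam_of_connected hT.connected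
  have hparity := even_dist_add_dist_add_dist hT.connected hT.isBipartite
  rw [isNPeripheral_three_iff (diam_ne_zero_of_connected hT.connected)] at h3
  refine ⟨hss', fun a ha => ?_, fun a ha => ?_⟩
  · have has : T.dist a s ≠ T.diam := fun has => h3 ⟨a, s, s', has, hss', ha⟩
    have := hparity a s s'
    grind
  · have has' : T.dist a s' + 1 ≠ T.diam := fun has' =>
      hleaf a (isNPeripheral_addLeaf hT hss' ha has')
    have := hparity a s s'
    grind

end AddLeaf

theorem exists_isSlimPair_iff {V : Type*} [Finite V] [Nontrivial V] {T : SimpleGraph V}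
    (hT : T.IsTree) :
    (∃ s s', IsSlimPair T s s') ↔
      ¬ T.IsNPeripheral 3 ∧ ¬ Nonempty (T ≃g pathGraph 2) ∧ ¬ T.IsWeaklyNonThreePeripheral := by
  rw [nonempty_iso_pathGraph_two_iff hT.isBipartite]
  constructor
  · rintro ⟨s, s', h⟩
    refine ⟨h.not_isNPeripheral hT, by have := h.two_le_diam; lia, ?_⟩
    rintro ⟨-, ⟨-, hremove⟩ | ⟨heven, u, hu⟩⟩
    · exact h.not_isNPeripheral_removeDiametral hT
        (hremove s ((isPeripheral_iff hT.connected).mpr ⟨s', h.dist_eq⟩))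
    · exact h.not_isNPeripheral_addLeaf hT heven hu
  · rintro ⟨h3, hne, hweak⟩
    simp only [IsWeaklyNonThreePeripheral, h3, not_false_eq_true, true_and] at hweak
    push Not at hweak
    rcases Nat.even_or_odd T.diam with heven | hodd
    · obtain ⟨s, s', hss'⟩ := T.exists_dist_eq_diam
      exact ⟨s, s', isSlimPair_of_even hT heven h3 (hweak.2 heven) hss'⟩
    · obtain ⟨s, hs, hs3⟩ := hweak.1 hodd
      obtain ⟨s', hss'⟩ := (isPeripheral_iff hT.connected).mp hs
      exact ⟨s, s', isSlimPair_of_odd hT hodd hne hss' hs3⟩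

/-! ### The maximal number of colors of a rainbow-free coloring -/

/-- `M` is the largest number of colors in a rainbow-free coloring of `G` in which every color
occurs. For finite `G` this number is one less than the anti-van der Waerden number, and unlike the
latter it is additive over connected components. -/
def IsMaxColors {V : Type*} (G : SimpleGraph V) (M : ℕ) : Prop :=
  IsGreatest {r | ∃ c : V → Fin r, Function.Surjective c ∧ RainbowFree G c} M

section MaxColors

variable {V W κ κ' : Type*} {G : SimpleGraph V} {H : SimpleGraph W} {M r : ℕ}

theorem not_hasRainbowAP_three_iff {c : V → Fin r} :
    ¬ G.HasRainbowAP c 3 ↔ RainbowFree G c := by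
  constructor
  · intro h u v w huv hvw
    by_contra! hne
    obtain ⟨d, hd⟩ := ENat.ne_top_iff_exists.mp huv
    refine h ⟨![u, v, w], ⟨d, fun i j hij => ?_⟩, fun i j hij => ?_⟩ <;>
      fin_cases i <;> fin_cases j <;> simp_all
  · rintro h ⟨v, ⟨d, hd⟩, hinj⟩
    have h01 := hd 0 1 rfl
    have h12 := hd 1 2 rfl
    rcases h (v 0) (v 1) (v 2) (h01 ▸ ENat.natCast_ne_top d) (h01.trans h12.symm) with
      h' | h' | h' <;> exact absurd (hinj h') (by decide)

theorem RainbowFree.map {c : V → κ} (hc : RainbowFree G c) (f : κ → κ') :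
    RainbowFree G (f ∘ c) := fun u v w huv hvw => by
  rcases hc u v w huv hvw with h | h | h <;> simp [h]

theorem RainbowFree.exists_surjective_fin [Finite V] {c : V → κ} (hc : RainbowFree G c)
    (hr : r ≠ 0) (hle : r ≤ (Set.range c).ncard) :
    ∃ c' : V → Fin r, Function.Surjective c' ∧ RainbowFree G c' := by
  have : NeZero r := ⟨hr⟩
  have := Fintype.ofFinite (Set.range c)
  obtain ⟨e⟩ : Nonempty (Fin r ↪ Set.range c) := Function.Embedding.nonempty_of_card_le (by
    rwa [Fintype.card_fin, ← Nat.card_eq_fintype_card, Nat.card_coe_set_eq])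
  have hinj : Function.Injective (fun i => (e i : κ)) := Subtype.val_injective.comp e.injective
  refine ⟨Function.invFun (fun i => (e i : κ)) ∘ c, fun i => ?_, hc.map _⟩
  obtain ⟨v, hv⟩ := (e i).2
  exact ⟨v, by rw [Function.comp_apply, hv]; exact Function.leftInverse_invFun hinj i⟩

theorem exists_isMaxColors [Finite V] [Nonempty V] (G : SimpleGraph V) : ∃ M, IsMaxColors G M := by
  have hbdd : BddAbove {r | ∃ c : V → Fin r, Function.Surjective c ∧ RainbowFree G c} := by
    refine ⟨Nat.card V, ?_⟩
    rintro r ⟨c, hc, -⟩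
    simpa using Nat.card_le_card_of_surjective c hc
  refine ⟨_, Nat.sSup_mem ⟨1, fun _ => 0, ?_, fun _ _ _ _ _ => .inl rfl⟩ hbdd,
    fun _ => le_csSup hbdd⟩
  exact Function.surjective_to_subsingleton _

namespace IsMaxColors

theorem congr (h : IsMaxColors H M) (φ : G ≃g H) : IsMaxColors G M := by
  obtain ⟨⟨c, hc, hfree⟩, hle⟩ := h
  refine ⟨⟨c ∘ φ, hc.comp φ.surjective, hfree.comp (edist_iso φ)⟩, ?_⟩
  rintro r ⟨c', hc', hfree'⟩
  exact hle ⟨c' ∘ φ.symm, hc'.comp φ.symm.surjective, hfree'.comp (edist_iso φ.symm)⟩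

theorem ncard_range_le [Finite V] (h : IsMaxColors G M) {c : V → κ} (hc : RainbowFree G c) :
    (Set.range c).ncard ≤ M := by
  by_contra! hlt
  exact hlt.not_ge (h.2 (hc.exists_surjective_fin (by lia) le_rfl))

theorem antiVanDerWaerden_eq [Finite V] (h : IsMaxColors G M) :
    G.antiVanDerWaerden 3 = M + 1 := by
  refine IsLeast.csInf_eq ⟨⟨M.succ_pos, fun c hc => ?_⟩, fun r ⟨hr, hall⟩ => ?_⟩
  · by_contra hAP
    exact (h.2 ⟨c, hc, not_hasRainbowAP_three_iff.mp hAP⟩).not_gt M.lt_succ_self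
  · by_contra! hlt
    obtain ⟨c, hc, hfree⟩ := h.1
    obtain ⟨c', hc', hfree'⟩ := hfree.exists_surjective_fin hr.ne'
      (by rw [hc.range_eq, Set.ncard_univ, Nat.card_fin]; lia)
    exact not_hasRainbowAP_three_iff.mpr hfree' (hall c' hc')

end IsMaxColors

end MaxColors

section Components

variable {V : Type*} {G : SimpleGraph V}

theorem edist_toSimpleGraph (C : G.ConnectedComponent) (u v : C) :
    C.toSimpleGraph.edist u v = G.edist u v := by
  refine le_antisymm ?_ (edist_map_le C.toSimpleGraph_hom u v)
  obtain ⟨p, hp⟩ := (C.reachable_of_mem_supp u.2 v.2).exists_walk_length_eq_edist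
  have hsupp (x : V) (hx : x ∈ p.support) : x ∈ C.supp := by
    obtain ⟨q, -⟩ := Walk.mem_support_iff_exists_append.mp hx
    exact (ConnectedComponent.sound q.reachable).symm.trans u.2
  calc C.toSimpleGraph.edist u v ≤ (p.induce C.supp hsupp).length :=
        edist_le (G := C.toSimpleGraph) _
    _ = G.edist u v := by
      rw [← hp, ← Walk.length_map (Embedding.induce C.supp).toHom, Walk.map_induce]
      rfl

theorem rainbowFree_of_forall_component {κ : G.ConnectedComponent → Type*}
    {c : ∀ C : G.ConnectedComponent, C → κ C} (hc : ∀ C, RainbowFree C.toSimpleGraph (c C)) :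
    RainbowFree G fun v => (⟨_, c _ ⟨v, ConnectedComponent.connectedComponentMk_mem⟩⟩ :
      Σ C, κ C) := by
  intro u v w huv hvw
  have hu : u ∈ G.connectedComponentMk v :=
    ConnectedComponent.sound (edist_ne_top_iff_reachable.mp huv)
  have hw : w ∈ G.connectedComponentMk v :=
    (ConnectedComponent.sound (edist_ne_top_iff_reachable.mp (hvw ▸ huv))).symm
  have color_eq (C : G.ConnectedComponent) (x : C) :
      (⟨_, c _ ⟨x, ConnectedComponent.connectedComponentMk_mem⟩⟩ : Σ C, κ C) = ⟨C, c C x⟩ := by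
    obtain ⟨x, rfl⟩ := x
    rfl
  have hC := hc (G.connectedComponentMk v) ⟨u, hu⟩ ⟨v, rfl⟩ ⟨w, hw⟩
  rw [edist_toSimpleGraph, edist_toSimpleGraph] at hC
  dsimp only
  rw [color_eq _ ⟨u, hu⟩, color_eq _ ⟨w, hw⟩]
  rcases hC huv hvw with h | h | h
  · exact .inl (congrArg _ h)
  · exact .inr (.inl (congrArg _ h))
  · exact .inr (.inr (congrArg _ h))

theorem isMaxColors_sum [Finite V] [Fintype G.ConnectedComponent] {m : G.ConnectedComponent → ℕ}
    (h : ∀ C : G.ConnectedComponent, IsMaxColors C.toSimpleGraph (m C)) :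
    IsMaxColors G (∑ C, m C) := by
  constructor
  · choose c hsurj hc using fun C => (h C).1
    let e : (Σ C, Fin (m C)) ≃ Fin (∑ C, m C) := Finite.equivFinOfCardEq (by simp)
    refine ⟨_, e.surjective.comp ?_, (rainbowFree_of_forall_component hc).map e⟩
    rintro ⟨C, i⟩
    obtain ⟨⟨v, rfl⟩, rfl⟩ := hsurj C i
    exact ⟨v, rfl⟩
  · rintro r ⟨c, hsurj, hc⟩
    have hrange : (Set.univ : Set (Fin r)) =
        ⋃ C ∈ (Finset.univ : Finset G.ConnectedComponent), Set.range fun v : C => c v := by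
      refine (Set.eq_univ_of_forall fun i => ?_).symm
      obtain ⟨v, rfl⟩ := hsurj i
      simpa using ⟨G.connectedComponentMk v, v, rfl, rfl⟩
    calc r = (Set.univ : Set (Fin r)).ncard := by simp [Set.ncard_univ]
      _ ≤ ∑ C : G.ConnectedComponent, (Set.range fun v : C => c v).ncard :=
        hrange ▸ Finset.set_ncard_biUnion_le _ _
      _ ≤ ∑ C, m C := Finset.sum_le_sum fun C _ =>
        (h C).ncard_range_le (hc.comp fun u v => (edist_toSimpleGraph C u v).symm)

theorem antiVanDerWaerden_three_eq_sum [Finite V] [Fintype G.ConnectedComponent] :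
    G.antiVanDerWaerden 3 =
      ∑ C : G.ConnectedComponent, (C.toSimpleGraph.antiVanDerWaerden 3 - 1) + 1 := by
  have hmax (C : G.ConnectedComponent) :
      IsMaxColors C.toSimpleGraph (C.toSimpleGraph.antiVanDerWaerden 3 - 1) := by
    have := C.connected_toSimpleGraph.nonempty
    obtain ⟨M, hM⟩ := exists_isMaxColors C.toSimpleGraph
    rwa [hM.antiVanDerWaerden_eq, Nat.add_sub_cancel]
  exact (isMaxColors_sum hmax).antiVanDerWaerden_eq

theorem antiVanDerWaerden_eq_of_forall_component [Finite V]
    (h : ∀ C : G.ConnectedComponent, C.toSimpleGraph.antiVanDerWaerden 3 = 3 ∨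
      C.toSimpleGraph.antiVanDerWaerden 3 = 4) :
    G.antiVanDerWaerden 3 =
      2 * (G.componentsWithAW 3).ncard + 3 * (G.componentsWithAW 4).ncard + 1 := by
  classical
  have := Fintype.ofFinite G.ConnectedComponent
  have hterm (C : G.ConnectedComponent) : C.toSimpleGraph.antiVanDerWaerden 3 - 1 =
      2 * (if C ∈ G.componentsWithAW 3 then 1 else 0) +
        3 * (if C ∈ G.componentsWithAW 4 then 1 else 0) := by
    rcases h C with hC | hC <;> simp [componentsWithAW, hC]
  have hcard (m : ℕ) :
      ∑ C, (if C ∈ G.componentsWithAW m then 1 else 0) = (G.componentsWithAW m).ncard := by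
    simp [Set.ncard_eq_toFinset_card']
  rw [antiVanDerWaerden_three_eq_sum, Finset.sum_congr rfl fun C _ => hterm C,
    Finset.sum_add_distrib, ← Finset.mul_sum, ← Finset.mul_sum, hcard, hcard]

end Components

/-! ### Products of trees -/

section Trees

variable {V W κ : Type*} {T : SimpleGraph V} {T' : SimpleGraph W}

theorem RainbowFree.swap {c : V × W → κ} (hc : RainbowFree (T □ T') c) :
    RainbowFree (T' □ T) (c ∘ Prod.swap) :=
  hc.comp (edist_iso (boxProdComm T' T))

theorem exists_pairwise_ne_of_surjective {r : ℕ} {c : V → Fin r} (hc : Function.Surjective c)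
    (hr : 2 < r) : ∃ u v w, c u ≠ c v ∧ c u ≠ c w ∧ c v ≠ c w := by
  obtain ⟨u, hu⟩ := hc ⟨0, by lia⟩
  obtain ⟨v, hv⟩ := hc ⟨1, by lia⟩
  obtain ⟨w, hw⟩ := hc ⟨2, hr⟩
  exact ⟨u, v, w, by simp [hu, hv], by simp [hu, hw], by simp [hv, hw]⟩

variable [Nontrivial V] [Nontrivial W]

theorem RainbowFree.le_three (hT : T.IsTree) (hT' : T'.IsTree) {r : ℕ} {c : V × W → Fin r}
    (hc : RainbowFree (T □ T') c) (hsurj : Function.Surjective c) : r ≤ 3 := by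
  by_contra! hlt
  obtain ⟨u, v, w, huv, huw, hvw⟩ := exists_pairwise_ne_of_surjective hsurj (by lia)
  obtain ⟨k, ω, b, b', hb⟩ := exists_goodPair (hT.connected.boxProd hT'.connected)
    (colorable_boxProd hT.isBipartite hT'.isBipartite) hc huv huw hvw
  have hsub : (Finset.univ : Finset (Fin r)) ⊆ {ω, c b, c b'} := fun i _ => by
    obtain ⟨v, rfl⟩ := hsurj i
    simpa using hb.color_eq_or_eq_or_eq hT hT' v
  have hcard := (Finset.card_le_card hsub).trans Finset.card_le_three
  rw [Finset.card_univ, Fintype.card_fin] at hcard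
  lia

variable [Finite V] [Finite W]

theorem not_threeCase_iff (hT : T.IsTree) (hT' : T'.IsTree) :
    ¬ ThreeCase T T' ↔ (¬ T.IsNPeripheral 3 ∧ ¬ T'.IsNPeripheral 3) ∧
      (Even (T.diam + T'.diam) →
        (∃ s s', IsSlimPair T s s') ∧ ∃ t t', IsSlimPair T' t t') := by
  rw [exists_isSlimPair_iff hT, exists_isSlimPair_iff hT', ThreeCase,
    diam_boxProd hT.connected hT'.connected]
  tauto

theorem exists_rainbowFree_of_not_threeCase (hT : T.IsTree) (hT' : T'.IsTree)
    (h : ¬ ThreeCase T T') :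
    ∃ c : V × W → Fin 3, Function.Surjective c ∧ RainbowFree (T □ T') c := by
  obtain ⟨⟨h₁, h₂⟩, hslim⟩ := (not_threeCase_iff hT hT').mp h
  rcases Nat.even_or_odd (T.diam + T'.diam) with heven | hodd
  · obtain ⟨⟨s, s', hs⟩, t, t', ht⟩ := hslim heven
    exact hs.exists_rainbowFree hT hT' ht heven
  · exact exists_rainbowFree_of_odd hT hT' hodd h₁ h₂

theorem RainbowFree.not_threeCase (hT : T.IsTree) (hT' : T'.IsTree) {c : V × W → κ}
    (hc : RainbowFree (T □ T') c) {p q r : V × W} (hpq : c p ≠ c q) (hpr : c p ≠ c r)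
    (hqr : c q ≠ c r) : ¬ ThreeCase T T' := by
  rw [not_threeCase_iff hT hT']
  refine ⟨⟨hc.not_isNPeripheral hT hT' hpq hpr hqr, ?_⟩,
    fun heven => ⟨hc.exists_isSlimPair hT hT' hpq hpr hqr heven, ?_⟩⟩
  · exact hc.swap.not_isNPeripheral hT' hT (p := p.swap) (q := q.swap) (r := r.swap) hpq hpr hqr
  · exact hc.swap.exists_isSlimPair hT' hT (p := p.swap) (q := q.swap) (r := r.swap) hpq hpr hqr
      (by rwa [add_comm])

theorem isMaxColors_two (hT : T.IsTree) (hT' : T'.IsTree) (h : ThreeCase T T') :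
    IsMaxColors (T □ T') 2 := by
  classical
  constructor
  · obtain ⟨v, w, hvw⟩ := exists_pair_ne (V × W)
    refine ⟨fun x => if x = v then 0 else 1, fun i => ?_, fun x y z _ _ => by lia⟩
    fin_cases i
    · exact ⟨v, by simp⟩
    · exact ⟨w, by simp [hvw.symm]⟩
  · rintro r ⟨c, hsurj, hc⟩
    by_contra! hlt
    obtain ⟨p, q, r, hpq, hpr, hqr⟩ := exists_pairwise_ne_of_surjective hsurj hlt
    exact hc.not_threeCase hT hT' hpq hpr hqr h

theorem isMaxColors_three (hT : T.IsTree) (hT' : T'.IsTree) (h : ¬ ThreeCase T T') :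
    IsMaxColors (T □ T') 3 :=
  ⟨exists_rainbowFree_of_not_threeCase hT hT' h, fun _ ⟨_, hsurj, hc⟩ => hc.le_three hT hT' hsurj⟩

end Trees

/-! ### Components of products of forests -/

section Forests

variable {V W : Type*} {F₁ : SimpleGraph V} {F₂ : SimpleGraph W}

theorem mem_connectedComponentMk_boxProd {x v : V} {y w : W} :
    (v, w) ∈ (F₁ □ F₂).connectedComponentMk (x, y) ↔
      v ∈ F₁.connectedComponentMk x ∧ w ∈ F₂.connectedComponentMk y :=
  ConnectedComponent.eq.trans (reachable_boxProd.trans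
    (and_congr ConnectedComponent.eq.symm ConnectedComponent.eq.symm))

/-- The component of a Cartesian product that contains `(x, y)` is the Cartesian product of the
components that contain `x` and `y`. -/
def componentBoxProdIso (F₁ : SimpleGraph V) (F₂ : SimpleGraph W) (x : V) (y : W) :
    ((F₁ □ F₂).connectedComponentMk (x, y)).toSimpleGraph ≃g
      (F₁.connectedComponentMk x).toSimpleGraph □ (F₂.connectedComponentMk y).toSimpleGraph where
  toFun v := (⟨v.1.1, (mem_connectedComponentMk_boxProd.mp v.2).1⟩,
    ⟨v.1.2, (mem_connectedComponentMk_boxProd.mp v.2).2⟩)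
  invFun p := ⟨(p.1.1, p.2.1), mem_connectedComponentMk_boxProd.mpr ⟨p.1.2, p.2.2⟩⟩
  left_inv _ := rfl
  right_inv _ := rfl
  map_rel_iff' := by
    intro v w
    simp [boxProd_adj, Subtype.ext_iff, ConnectedComponent.toSimpleGraph]

/-- The pair of components of the factors that a component of a Cartesian product projects to. -/
def componentPair (C : (F₁ □ F₂).ConnectedComponent) :
    F₁.ConnectedComponent × F₂.ConnectedComponent :=
  C.lift (fun v => (F₁.connectedComponentMk v.1, F₂.connectedComponentMk v.2)) fun _ _ p _ =>
    Prod.ext (ConnectedComponent.sound (reachable_boxProd.mp p.reachable).1)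
      (ConnectedComponent.sound (reachable_boxProd.mp p.reachable).2)

theorem componentPair_bijective :
    Function.Bijective (componentPair (F₁ := F₁) (F₂ := F₂)) := by
  constructor
  · intro C C' h
    induction C using ConnectedComponent.ind with | _ v
    induction C' using ConnectedComponent.ind with | _ v'
    obtain ⟨h₁, h₂⟩ := Prod.mk.injEq .. ▸ h
    exact ConnectedComponent.sound (reachable_boxProd.mpr
      ⟨ConnectedComponent.exact h₁, ConnectedComponent.exact h₂⟩)
  · rintro ⟨C, C'⟩
    induction C using ConnectedComponent.ind with | _ x
    induction C' using ConnectedComponent.ind with | _ y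
    exact ⟨(F₁ □ F₂).connectedComponentMk (x, y), rfl⟩

theorem ncard_preimage_componentPair (S : Set (F₁.ConnectedComponent × F₂.ConnectedComponent)) :
    (componentPair ⁻¹' S).ncard = S.ncard :=
  Set.ncard_preimage_of_injective_subset_range componentPair_bijective.1
    (componentPair_bijective.2.range_eq ▸ Set.subset_univ S)

theorem nontrivial_of_forall_not_isIsolated (h : ∀ x, ¬ F₁.IsIsolated x)
    (C : F₁.ConnectedComponent) : Nontrivial C := by
  induction C using ConnectedComponent.ind with | _ x
  obtain ⟨w, hw⟩ : ∃ w, F₁.Adj x w := by simpa [IsIsolated] using h x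
  exact ⟨⟨x, rfl⟩, ⟨w, (ConnectedComponent.sound hw.reachable).symm⟩,
    fun heq => hw.ne (congrArg Subtype.val heq)⟩

variable [Finite V] [Finite W]

open scoped Classical in
theorem antiVanDerWaerden_component_boxProd (hF₁ : F₁.IsAcyclic) (hF₂ : F₂.IsAcyclic)
    (h₁ : ∀ x, ¬ F₁.IsIsolated x) (h₂ : ∀ y, ¬ F₂.IsIsolated y)
    (C : (F₁ □ F₂).ConnectedComponent) :
    C.toSimpleGraph.antiVanDerWaerden 3 =
      if ThreeCase (componentPair C).1.toSimpleGraph (componentPair C).2.toSimpleGraph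
      then 3 else 4 := by
  induction C using ConnectedComponent.ind with | _ v
  obtain ⟨x, y⟩ := v
  have := nontrivial_of_forall_not_isIsolated h₁ (F₁.connectedComponentMk x)
  have := nontrivial_of_forall_not_isIsolated h₂ (F₂.connectedComponentMk y)
  have hT := hF₁.isTree_connectedComponent (F₁.connectedComponentMk x)
  have hT' := hF₂.isTree_connectedComponent (F₂.connectedComponentMk y)
  split_ifs with h
  · exact ((isMaxColors_two hT hT' h).congr (componentBoxProdIso F₁ F₂ x y)).antiVanDerWaerden_eq
  · exact ((isMaxColors_three hT hT' h).congr (componentBoxProdIso F₁ F₂ x y)).antiVanDerWaerden_eq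

theorem componentsWithAW_three_boxProd (hF₁ : F₁.IsAcyclic) (hF₂ : F₂.IsAcyclic)
    (h₁ : ∀ x, ¬ F₁.IsIsolated x) (h₂ : ∀ y, ¬ F₂.IsIsolated y) :
    (F₁ □ F₂).componentsWithAW 3 =
      componentPair ⁻¹' {p | ThreeCase p.1.toSimpleGraph p.2.toSimpleGraph} := by
  ext C
  simp [componentsWithAW, antiVanDerWaerden_component_boxProd hF₁ hF₂ h₁ h₂]

theorem componentsWithAW_four_boxProd (hF₁ : F₁.IsAcyclic) (hF₂ : F₂.IsAcyclic)
    (h₁ : ∀ x, ¬ F₁.IsIsolated x) (h₂ : ∀ y, ¬ F₂.IsIsolated y) :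
    (F₁ □ F₂).componentsWithAW 4 =
      componentPair ⁻¹' {p | ¬ ThreeCase p.1.toSimpleGraph p.2.toSimpleGraph} := by
  ext C
  simp [componentsWithAW, antiVanDerWaerden_component_boxProd hF₁ hF₂ h₁ h₂]

end Forests

end AntiVanDerWaerden

theorem mainTheorem3 {V₁ V₂ : Type*} [Finite V₁] [Finite V₂]
    (F₁ : SimpleGraph V₁) (F₂ : SimpleGraph V₂)
    (hF₁ : F₁.IsAcyclic) (hF₂ : F₂.IsAcyclic)
    (hiso₁ : ∀ v : V₁, ¬ F₁.IsIsolated v) (hiso₂ : ∀ v : V₂, ¬ F₂.IsIsolated v) :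
    (F₁ □ F₂).antiVanDerWaerden 3 =
        2 * ((F₁ □ F₂).componentsWithAW 3).ncard + 3 * ((F₁ □ F₂).componentsWithAW 4).ncard + 1 ∧
      (∀ (x : V₁) (y : V₂),
        ((F₁ □ F₂).connectedComponentMk (x, y) ∈ (F₁ □ F₂).componentsWithAW 3 ↔
          (F₁.connectedComponentMk x).toSimpleGraph.ThreeCase
            (F₂.connectedComponentMk y).toSimpleGraph) ∧
        ((F₁ □ F₂).connectedComponentMk (x, y) ∈ (F₁ □ F₂).componentsWithAW 4 ↔
          ¬ (F₁.connectedComponentMk x).toSimpleGraph.ThreeCase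
            (F₂.connectedComponentMk y).toSimpleGraph)) ∧
      ((F₁ □ F₂).componentsWithAW 3).ncard =
        {p : F₁.ConnectedComponent × F₂.ConnectedComponent |
          p.1.toSimpleGraph.ThreeCase p.2.toSimpleGraph}.ncard ∧
      ((F₁ □ F₂).componentsWithAW 4).ncard =
        {p : F₁.ConnectedComponent × F₂.ConnectedComponent |
          ¬ p.1.toSimpleGraph.ThreeCase p.2.toSimpleGraph}.ncard := by
  have h3 := AntiVanDerWaerden.componentsWithAW_three_boxProd hF₁ hF₂ hiso₁ hiso₂
  have h4 := AntiVanDerWaerden.componentsWithAW_four_boxProd hF₁ hF₂ hiso₁ hiso₂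
  refine ⟨AntiVanDerWaerden.antiVanDerWaerden_eq_of_forall_component fun C => ?_,
    fun x y => ⟨?_, ?_⟩, ?_, ?_⟩
  · rw [AntiVanDerWaerden.antiVanDerWaerden_component_boxProd hF₁ hF₂ hiso₁ hiso₂]
    split_ifs <;> simp
  · exact h3 ▸ Iff.rfl
  · exact h4 ▸ Iff.rfl
  · rw [h3, AntiVanDerWaerden.ncard_preimage_componentPair]
  · rw [h4, AntiVanDerWaerden.ncard_preimage_componentPair]
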